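/- Let $M$ be a complex manifold with $\dim_{\mathbb C}M=2$ and let $\mathcal T_M$ be its holomorphic tangent bundle. Let $h$ be a smooth Hermitian metric on $\mathcal T_M$ (complex linear in the first argument, positive definite), with Chern connection $D=D'+\bar\partial$. For an endomorphism (or endomorphism-valued form) $P$ let $P^\dagger$ be its $h$-adjoint. Let $\Phi$ be a $(1,0)$-form with values in $\mathrm{End}(\mathcal T_M)$, let $\mathcal U,\mathcal Q$ be smooth ($C^\infty$) complex-linear endomorphisms of $\mathcal T_M$, and let $\kappa$ be a smooth conjugate-linear endomorphism of $\mathcal T_M$. Assume that $(\mathcal T_M,h,\Phi,\kappa,\mathcal U,\mathcal Q)$ is a tt*-bundle, that is: * (harmonic Higgs bundle) $\bar\partial(\Phi)=0$, $\Phi\wedge\Phi=0$, and the connection $D'+\bar\partial+\Phi+\Phi^\dagger$ is integrable, i.e. in addition $(D')^2=0$, $D'(\Phi^\dagger)=0$, $\Phi^\dagger\wedge\Phi^\dagger=0$, $D'(\Phi)=0$, $\bar\partial(\Phi^\dagger)=0$ and $D'\bar\partial+\bar\partial D'=-(\Phi\Phi^\dagger+\Phi^\dagger\Phi)$; * (integrability)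 $\bar\partial(\mathcal U)=0$, $\mathcal Q^\dagger=\mathcal Q$, $[\Phi,\mathcal U]=0$, $D'(\mathcal U)-[\Phi,\mathcal Q]+\Phi=0$ and $D'(\mathcal Q)+[\Phi,\mathcal U^\dagger]=0$; * (real structure) $\kappa^2=\mathrm{Id}$, $h(\kappa X,\kappa Y)=\overline{h(X,Y)}$ and $D(\kappa)=0$; * (compatibility) $\mathcal U^*=\mathcal U$ and $\mathcal Q^*+\mathcal Q=0$, where $*$ denotes the adjoint with respect to the complex bilinear form $g(X,Y)=h(X,\kappa Y)$. Assume moreover that $D'(\mathcal U)=0$, and let $p\in M$. 1. If neither $\tfrac12$ nor $-\tfrac12$ is an eigenvalue of $\mathcal Q(p)$, then there is an open neighborhood $U_p$ of $p$ such that $\Phi|_{U_p}=0$ and $D'|_{U_p}$ is a holomorphic connection, i.e. $D'\bar\partial+\bar\partial D'=0$ on $U_p$. 2. If $\tfrac12$ is an eigenvalue of $\mathcal Q(p)$ and $D'$ is a holomorphic connection on $M$ (i.e. $D'\bar\partial+\bar\partial D'=0$), then there are an open neighborhood $U_p$ of $p$ and a holomorphic frame $X_1,X_2$ of $\mathcal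 T_M$ over $U_p$ that is $D'$-flat ($D'X_1=D'X_2=0$) and in which the matrix of $\mathcal Q$ is constant and equal to $\begin{pmatrix}\frac12&0\\0&-\frac12\end{pmatrix}$, and moreover $\Phi|_{U_p}=0$. -/

import Mathlib

open scoped Manifold ContDiff Matrix ComplexConjugate

noncomputable section

namespace TTStar

/-- The model space `ℂⁿ`. -/
abbrev Cn (n : ℕ) : Type := EuclideanSpace ℂ (Fin n)

/-! ### Wirtinger derivatives on `ℂⁿ` -/

/-- `∂f/∂zᵃ = (∂f/∂xᵃ - i ∂f/∂yᵃ) / 2`. -/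
def dz {n : ℕ} (a : Fin n) (f : Cn n → ℂ) (z : Cn n) : ℂ :=
  (fderiv ℝ f z (EuclideanSpace.single a 1)
    - Complex.I * fderiv ℝ f z (EuclideanSpace.single a Complex.I)) / 2

/-- `∂f/∂z̄ᵃ = (∂f/∂xᵃ + i ∂f/∂yᵃ) / 2`. -/
def dzbar {n : ℕ} (a : Fin n) (f : Cn n → ℂ) (z : Cn n) : ℂ :=
  (fderiv ℝ f z (EuclideanSpace.single a 1)
    + Complex.I * fderiv ℝ f z (EuclideanSpace.single a Complex.I)) / 2

/-- Entrywise `∂/∂zᵃ` of a matrix-valued function. -/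
def mdz {n : ℕ} (a : Fin n) (F : Cn n → Matrix (Fin n) (Fin n) ℂ) (z : Cn n) :
    Matrix (Fin n) (Fin n) ℂ :=
  Matrix.of fun i j => dz a (fun w => F w i j) z

/-- Entrywise `∂/∂z̄ᵃ` of a matrix-valued function. -/
def mdzbar {n : ℕ} (a : Fin n) (F : Cn n → Matrix (Fin n) (Fin n) ℂ) (z : Cn n) :
    Matrix (Fin n) (Fin n) ℂ :=
  Matrix.of fun i j => dzbar a (fun w => F w i j) z

/-- Entrywise `C^∞` (in the real sense) on a set. -/
def SmoothMatOn {n : ℕ} (F : Cn n → Matrix (Fin n) (Fin n) ℂ) (s : Set (Cn n)) : Prop :=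
  ∀ i j, ContDiffOn ℝ ∞ (fun z => F z i j) s

/-- The commutator of two matrices. -/
def comm {n : ℕ} (A B : Matrix (Fin n) (Fin n) ℂ) : Matrix (Fin n) (Fin n) ℂ :=
  A * B - B * A

variable {n : ℕ} {M : Type*} [TopologicalSpace M] [ChartedSpace (Cn n) M]

/-! ### Tensor fields on the holomorphic tangent bundle

`TangentSpace 𝓘(ℂ, Cn n) x` is the fibre at `x` of the holomorphic tangent bundle `T_M`
(equivalently of `T^{1,0} M`). -/

variable (n M) in
/-- Fields of endomorphisms of `T_M`. -/
abbrev EndField : Type _ := ∀ x : M, Module.End ℂ (TangentSpace 𝓘(ℂ, Cn n) x)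

variable (n M) in
/-- Fields of sesquilinear forms on `T_M`, linear in the first and conjugate-linear in the
second argument. -/
abbrev SesqField : Type _ := ∀ x : M,
  TangentSpace 𝓘(ℂ, Cn n) x →ₗ[ℂ] TangentSpace 𝓘(ℂ, Cn n) x →ₗ⋆[ℂ] ℂ

variable (n M) in
/-- Fields of conjugate-linear endomorphisms of `T_M`. -/
abbrev AntiField : Type _ := ∀ x : M,
  TangentSpace 𝓘(ℂ, Cn n) x →ₗ⋆[ℂ] TangentSpace 𝓘(ℂ, Cn n) x

variable (n M) in
/-- `(1,0)`-forms with values in the endomorphisms of `T_M`; `Φ x X` is `Φ_X`. -/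
abbrev HiggsField : Type _ := ∀ x : M,
  TangentSpace 𝓘(ℂ, Cn n) x →ₗ[ℂ] Module.End ℂ (TangentSpace 𝓘(ℂ, Cn n) x)

variable (n M) in
/-- Vector fields, that is, sections of `T_M`. -/
abbrev VectField : Type _ := ∀ x : M, TangentSpace 𝓘(ℂ, Cn n) x

/-! ### Local expressions in a holomorphic chart -/

/-- The coordinate vector `∂/∂zⁱ` of the chart `e` at the point `e⁻¹(z)`. -/
def coordVec (e : OpenPartialHomeomorph M (Cn n)) (z : Cn n) (i : Fin n) :
    TangentSpace 𝓘(ℂ, Cn n) (e.symm z) :=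
  mfderiv 𝓘(ℂ, Cn n) 𝓘(ℂ, Cn n) e.symm z (EuclideanSpace.single i (1 : ℂ) : Cn n)

/-- The vector of components, in the chart `e`, of a tangent vector at `e⁻¹(z)`. -/
def comp (e : OpenPartialHomeomorph M (Cn n)) (z : Cn n)
    (v : TangentSpace 𝓘(ℂ, Cn n) (e.symm z)) : Cn n :=
  mfderiv 𝓘(ℂ, Cn n) 𝓘(ℂ, Cn n) e (e.symm z) v

/-- The matrix of an endomorphism field in the coordinate frame:
`A ∂_j = ∑ₖ (endMat e A)ₖⱼ ∂ₖ`. -/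
def endMat (e : OpenPartialHomeomorph M (Cn n)) (A : EndField n M) (z : Cn n) :
    Matrix (Fin n) (Fin n) ℂ :=
  Matrix.of fun k j => comp e z (A (e.symm z) (coordVec e z j)) k

/-- The matrix of a conjugate-linear endomorphism field in the coordinate frame:
`κ ∂_j = ∑ₖ (antiMat e κ)ₖⱼ ∂ₖ`. -/
def antiMat (e : OpenPartialHomeomorph M (Cn n)) (κ : AntiField n M) (z : Cn n) :
    Matrix (Fin n) (Fin n) ℂ :=
  Matrix.of fun k j => comp e z (κ (e.symm z) (coordVec e z j)) k

/-- The matrix `Φₐ` of `Φ_{∂/∂zᵃ}` in the coordinate frame, so that `Φ = ∑ₐ Φₐ dzᵃ`. -/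
def higgsMat (e : OpenPartialHomeomorph M (Cn n)) (Φ : HiggsField n M) (a : Fin n) (z : Cn n) :
    Matrix (Fin n) (Fin n) ℂ :=
  Matrix.of fun k j => comp e z (Φ (e.symm z) (coordVec e z a) (coordVec e z j)) k

/-- The Gram matrix `Gᵢⱼ = h(∂ⱼ, ∂ᵢ)`, so that `h(x, y) = y* G x` in coordinates. -/
def gram (e : OpenPartialHomeomorph M (Cn n)) (h : SesqField n M) (z : Cn n) :
    Matrix (Fin n) (Fin n) ℂ :=
  Matrix.of fun i j => h (e.symm z) (coordVec e z j) (coordVec e z i)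

/-- The matrix `G⁻¹ A* G` of the `h`-adjoint `A†` (`h(A x, y) = h(x, A† y)`), where `A` is the
matrix of an endomorphism in the coordinate frame at `e⁻¹(z)`. -/
def adj (e : OpenPartialHomeomorph M (Cn n)) (h : SesqField n M) (z : Cn n)
    (A : Matrix (Fin n) (Fin n) ℂ) : Matrix (Fin n) (Fin n) ℂ :=
  (gram e h z)⁻¹ * Aᴴ * gram e h z

/-- The component `Φₐ†` of the `(0,1)`-form `Φ† = ∑ₐ Φₐ† dz̄ᵃ`. -/
def higgsAdj (e : OpenPartialHomeomorph M (Cn n)) (h : SesqField n M) (Φ : HiggsField n M)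
    (a : Fin n) (z : Cn n) : Matrix (Fin n) (Fin n) ℂ :=
  adj e h z (higgsMat e Φ a z)

/-- The Chern connection of `h` in the holomorphic coordinate frame: `D'_a ∂ⱼ = ∑ₖ (Aₐ)ₖⱼ ∂ₖ`
with `Aₐ = G⁻¹ ∂ₐ G`, the only solution of `∂ₐ h(s, t) = h(D'_a s, t)` for all sections `s, t`
of the coordinate frame with constant coefficients. -/
def chern (e : OpenPartialHomeomorph M (Cn n)) (h : SesqField n M) (a : Fin n) (z : Cn n) :
    Matrix (Fin n) (Fin n) ℂ :=
  (gram e h z)⁻¹ * mdz a (gram e h) z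

/-- `D'_a` on matrices of endomorphisms: `D'_a (B) = ∂ₐ B + [Aₐ, B]`. -/
def chernEnd (e : OpenPartialHomeomorph M (Cn n)) (h : SesqField n M) (a : Fin n)
    (B : Cn n → Matrix (Fin n) (Fin n) ℂ) (z : Cn n) : Matrix (Fin n) (Fin n) ℂ :=
  mdz a B z + comm (chern e h a z) (B z)

/-- `D'_a` on sections of `T_M`, in components: `(D'_a s)ᵏ = ∂ₐ sᵏ + ∑ⱼ (Aₐ)ₖⱼ sʲ`. -/
def chernSec (e : OpenPartialHomeomorph M (Cn n)) (h : SesqField n M) (a : Fin n)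
    (s : VectField n M) (z : Cn n) : Fin n → ℂ :=
  fun k => dz a (fun w => comp e w (s (e.symm w)) k) z
    + ∑ j, chern e h a z k j * comp e z (s (e.symm z)) j

/-! ### The structures -/

/-- `(T_M, h)` is a Hermitian holomorphic bundle: `h` is a smooth non-degenerate Hermitian
sesquilinear form. -/
structure IsHermitian (h : SesqField n M) : Prop where
  herm : ∀ x v w, h x w v = conj (h x v w)
  nondeg : ∀ x v, (∀ w, h x v w = 0) → v = 0
  smooth : ∀ e ∈ atlas (Cn n) M, SmoothMatOn (gram e h) e.target

/-- `h` is positive definite. -/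
def PosDef (h : SesqField n M) : Prop :=
  ∀ x v, v ≠ 0 → 0 < (h x v v).re

/-- `Φ` is a (holomorphic) Higgs field on `T_M`: `∂̄(Φ) = 0` and `Φ ∧ Φ = 0`. -/
structure IsHiggs (Φ : HiggsField n M) : Prop where
  smooth : ∀ e ∈ atlas (Cn n) M, ∀ a, SmoothMatOn (higgsMat e Φ a) e.target
  holomorphic : ∀ e ∈ atlas (Cn n) M, ∀ z ∈ e.target, ∀ a b, mdzbar b (higgsMat e Φ a) z = 0
  wedge : ∀ e ∈ atlas (Cn n) M, ∀ z ∈ e.target, ∀ a b,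
    comm (higgsMat e Φ a z) (higgsMat e Φ b z) = 0

/-- `(T_M, h, Φ)` is a harmonic Higgs bundle: `D' + ∂̄ + Φ + Φ†` is integrable, written out as
the relations `(D')² = 0`, `D'(Φ†) = 0`, `Φ† ∧ Φ† = 0`, `D'(Φ) = 0`, `∂̄(Φ†) = 0` and
`D'∂̄ + ∂̄D' = -(Φ Φ† + Φ† Φ)`. Here `D'∂̄ + ∂̄D' = ∑ (∂̄_b Aₐ) dz̄ᵇ ∧ dzᵃ` and
`Φ Φ† + Φ† Φ = ∑ [Φₐ, Φ_b†] dzᵃ ∧ dz̄ᵇ`. -/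
structure IsHarmonicHiggs (h : SesqField n M) (Φ : HiggsField n M) : Prop where
  hermitian : IsHermitian h
  higgs : IsHiggs Φ
  chern_sq : ∀ e ∈ atlas (Cn n) M, ∀ z ∈ e.target, ∀ a b,
    mdz a (chern e h b) z - mdz b (chern e h a) z + comm (chern e h a z) (chern e h b z) = 0
  chern_higgsAdj : ∀ e ∈ atlas (Cn n) M, ∀ z ∈ e.target, ∀ a b,
    chernEnd e h a (higgsAdj e h Φ b) z = 0
  wedge_adj : ∀ e ∈ atlas (Cn n) M, ∀ z ∈ e.target, ∀ a b,
    comm (higgsAdj e h Φ a z) (higgsAdj e h Φ b z) = 0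
  chern_higgs : ∀ e ∈ atlas (Cn n) M, ∀ z ∈ e.target, ∀ a b,
    chernEnd e h a (higgsMat e Φ b) z - chernEnd e h b (higgsMat e Φ a) z = 0
  dbar_higgsAdj : ∀ e ∈ atlas (Cn n) M, ∀ z ∈ e.target, ∀ a b,
    mdzbar a (higgsAdj e h Φ b) z - mdzbar b (higgsAdj e h Φ a) z = 0
  curvature : ∀ e ∈ atlas (Cn n) M, ∀ z ∈ e.target, ∀ a b,
    mdzbar b (chern e h a) z = comm (higgsMat e Φ a z) (higgsAdj e h Φ b z)

/-- `(T_M, h, Φ, U, Q)` is an integrable harmonic Higgs bundle: `∂̄(U) = 0`, `Q† = Q`,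
`[Φ, U] = 0`, `D'(U) - [Φ, Q] + Φ = 0`, `D'(Q) + [Φ, U†] = 0`. -/
structure IsIntegrableHarmonicHiggs (h : SesqField n M) (Φ : HiggsField n M)
    (U Q : EndField n M) : Prop where
  harmonic : IsHarmonicHiggs h Φ
  smooth_U : ∀ e ∈ atlas (Cn n) M, SmoothMatOn (endMat e U) e.target
  smooth_Q : ∀ e ∈ atlas (Cn n) M, SmoothMatOn (endMat e Q) e.target
  dbar_U : ∀ e ∈ atlas (Cn n) M, ∀ z ∈ e.target, ∀ a, mdzbar a (endMat e U) z = 0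
  Q_selfAdj : ∀ x v w, h x (Q x v) w = h x v (Q x w)
  comm_U : ∀ x v, Φ x v * U x - U x * Φ x v = 0
  chern_U : ∀ e ∈ atlas (Cn n) M, ∀ z ∈ e.target, ∀ a,
    chernEnd e h a (endMat e U) z - comm (higgsMat e Φ a z) (endMat e Q z) + higgsMat e Φ a z = 0
  chern_Q : ∀ e ∈ atlas (Cn n) M, ∀ z ∈ e.target, ∀ a,
    chernEnd e h a (endMat e Q) z + comm (higgsMat e Φ a z) (adj e h z (endMat e U z)) = 0

/-- `κ` is a real structure on `(T_M, h)`: a smooth conjugate-linear involution with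
`h(κ x, κ y) = conj h(x, y)` and `D(κ) = 0`. With `K` the matrix of `κ`, `κ v = K v̄` in
coordinates; `D(κ) = 0` says `D'_a (κ s) = κ (∂̄_a s)` and `∂̄_a (κ s) = κ (D'_a s)`, that is,
`∂ₐ K + Aₐ K = 0` and `∂̄ₐ K = K conj(Aₐ)`. -/
structure IsRealStructure (h : SesqField n M) (κ : AntiField n M) : Prop where
  smooth : ∀ e ∈ atlas (Cn n) M, SmoothMatOn (antiMat e κ) e.target
  invol : ∀ x v, κ x (κ x v) = v
  conj_h : ∀ x v w, h x (κ x v) (κ x w) = conj (h x v w)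
  parallel : ∀ e ∈ atlas (Cn n) M, ∀ z ∈ e.target, ∀ a,
    mdz a (antiMat e κ) z + chern e h a z * antiMat e κ z = 0
  parallel_bar : ∀ e ∈ atlas (Cn n) M, ∀ z ∈ e.target, ∀ a,
    mdzbar a (antiMat e κ) z = antiMat e κ z * (chern e h a z).map conj

/-- `(T_M, h, Φ, κ, U, Q)` is a tt*-bundle. The adjoint `*` is taken with respect to the complex
bilinear form `g(x, y) = h(x, κ y)`. -/
structure IsTTStarBundle (h : SesqField n M) (Φ : HiggsField n M) (κ : AntiField n M)
    (U Q : EndField n M) : Prop where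
  integrable : IsIntegrableHarmonicHiggs h Φ U Q
  real : IsRealStructure h κ
  U_star : ∀ x v w, h x (U x v) (κ x w) = h x v (κ x (U x w))
  Q_star : ∀ x v w, h x (Q x v) (κ x w) + h x v (κ x (Q x w)) = 0

/-- `D'(B) = 0` on `M`, for an endomorphism field `B`. -/
def IsChernParallel (h : SesqField n M) (B : EndField n M) : Prop :=
  ∀ e ∈ atlas (Cn n) M, ∀ z ∈ e.target, ∀ a, chernEnd e h a (endMat e B) z = 0

/-- `D'` is a holomorphic connection on the open set `W`: `D'∂̄ + ∂̄D' = 0` there. -/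
def IsHolomorphicChernOn (h : SesqField n M) (W : Set M) : Prop :=
  ∀ e ∈ atlas (Cn n) M, ∀ z ∈ e.target, e.symm z ∈ W → ∀ a b, mdzbar b (chern e h a) z = 0

/-- The vector field `s` is `D'`-flat on `W`: `D' s = 0` there. -/
def IsFlatOn (h : SesqField n M) (s : VectField n M) (W : Set M) : Prop :=
  ∀ e ∈ atlas (Cn n) M, ∀ z ∈ e.target, e.symm z ∈ W → ∀ a, chernSec e h a s z = 0

/-- `X₁, …, Xₙ` is a `D'`-flat holomorphic frame of `T_M` over the open set `W`. -/
structure IsFlatHolomorphicFrameOn [IsManifold 𝓘(ℂ, Cn n) 1 M] (h : SesqField n M)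
    (X : Fin n → VectField n M) (W : Set M) : Prop where
  holomorphic : ∀ j, MDifferentiableOn 𝓘(ℂ, Cn n) 𝓘(ℂ, Cn n).tangent
    (fun x => (⟨x, X j x⟩ : TangentBundle 𝓘(ℂ, Cn n) M)) W
  linearIndependent : ∀ x ∈ W, LinearIndependent ℂ (fun j => X j x)
  flat : ∀ j, IsFlatOn h (X j) W

end TTStar

end

noncomputable section

namespace TTStar

variable {n : ℕ}

/-! ### Wirtinger calculus -/

/-! Everything rests on the identity `[Φ, Q] = Φ`, which is what the equation for `D'(U)` becomes
when `D'(U) = 0`. The relation `Q* = -Q` makes `Q` similar to `-Qᵀ`, so `Q` has trace zero and, in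
rank two, `Q²` is a scalar. For a component `N` of `Φ` the commutator with `Q²` then vanishes, which
gives `NQ + QN = 0`; with `NQ - QN = N` this yields `NQ = N/2` and `N² = 0`.

Part 1: `N (Q - 1/2) = 0`, and `Q - 1/2` stays invertible near `p`, so `Φ = 0` there, and the
curvature identity makes `D'` holomorphic (`eq_zero_of_comm_eq`,
`IsTTStarBundle.exists_higgs_eq_zero`).

Part 2: vanishing curvature says that `N` commutes with `N†`. A nilpotent normal operator for a
positive definite metric is zero, so `Φ = 0` (`eq_zero_of_normal_of_sq_eq_zero`). Then `D'(Q) = 0`,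
and self-adjointness gives `∂̄(Q) = 0`. Hence `det Q` is locally constant, equal to `-1/4`, and `1/2
± Q` are parallel holomorphic projectors of rank one. Rescaling a column of such a projector by the
exponential of a primitive of a closed 1-form gives a flat eigenvector field (`exists_flat_section`,
`exists_flat_eigenvector`). The construction lives in one chart; `isFlatOn_chartField` carries
flatness to every chart. -/

theorem dz_congr {a : Fin n} {f g : Cn n → ℂ} {z : Cn n} (h : f =ᶠ[nhds z] g) :
    dz a f z = dz a g z := by
  simp only [dz, h.fderiv_eq]

theorem dzbar_congr {a : Fin n} {f g : Cn n → ℂ} {z : Cn n} (h : f =ᶠ[nhds z] g) :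
    dzbar a f z = dzbar a g z := by
  simp only [dzbar, h.fderiv_eq]

theorem dz_mul (a : Fin n) {f g : Cn n → ℂ} {z : Cn n} (hf : DifferentiableAt ℝ f z)
    (hg : DifferentiableAt ℝ g z) :
    dz a (fun w => f w * g w) z = dz a f z * g z + f z * dz a g z := by
  simp only [dz, fderiv_fun_mul hf hg, add_apply,
    smul_apply, smul_eq_mul]
  ring

theorem dzbar_mul (a : Fin n) {f g : Cn n → ℂ} {z : Cn n} (hf : DifferentiableAt ℝ f z)
    (hg : DifferentiableAt ℝ g z) :
    dzbar a (fun w => f w * g w) z = dzbar a f z * g z + f z * dzbar a g z := by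
  simp only [dzbar, fderiv_fun_mul hf hg, add_apply,
    smul_apply, smul_eq_mul]
  ring

theorem dz_sum {ι : Type*} (s : Finset ι) (a : Fin n) {f : ι → Cn n → ℂ} {z : Cn n}
    (hf : ∀ i ∈ s, DifferentiableAt ℝ (f i) z) :
    dz a (fun w => ∑ i ∈ s, f i w) z = ∑ i ∈ s, dz a (f i) z := by
  simp only [dz, fderiv_fun_sum hf, sum_apply, Finset.mul_sum,
    ← Finset.sum_sub_distrib, Finset.sum_div]

theorem dzbar_sum {ι : Type*} (s : Finset ι) (a : Fin n) {f : ι → Cn n → ℂ} {z : Cn n}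
    (hf : ∀ i ∈ s, DifferentiableAt ℝ (f i) z) :
    dzbar a (fun w => ∑ i ∈ s, f i w) z = ∑ i ∈ s, dzbar a (f i) z := by
  simp only [dzbar, fderiv_fun_sum hf, sum_apply, Finset.mul_sum,
    ← Finset.sum_add_distrib, Finset.sum_div]

theorem fderiv_conj_apply {f : Cn n → ℂ} (z v : Cn n) :
    fderiv ℝ (fun w => conj (f w)) z v = conj (fderiv ℝ f z v) := by
  have := Complex.conjCLE.comp_fderiv (f := f) (x := z)
  have h2 : (fun w => conj (f w)) = Complex.conjCLE ∘ f := by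
    funext w; simp
  rw [h2, this]
  simp

theorem dzbar_conj (a : Fin n) (f : Cn n → ℂ) (z : Cn n) :
    dzbar a (fun w => conj (f w)) z = conj (dz a f z) := by
  simp only [dz, dzbar, fderiv_conj_apply]
  simp [sub_eq_add_neg, map_ofNat]

theorem dz_of_complex (a : Fin n) {f : Cn n → ℂ} {z : Cn n} (hf : DifferentiableAt ℂ f z) :
    dz a f z = fderiv ℂ f z (EuclideanSpace.single a 1) := by
  have h1 : EuclideanSpace.single a Complex.I
      = Complex.I • (EuclideanSpace.single a 1 : Cn n) := by
    ext i; simp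
  rw [dz, hf.fderiv_restrictScalars ℝ, h1]
  simp only [ContinuousLinearMap.coe_restrictScalars', map_smul, smul_eq_mul]
  linear_combination (-(1/2 : ℂ) * fderiv ℂ f z (EuclideanSpace.single a 1)) * Complex.I_mul_I

theorem dzbar_of_complex (a : Fin n) {f : Cn n → ℂ} {z : Cn n} (hf : DifferentiableAt ℂ f z) :
    dzbar a f z = 0 := by
  have h1 : EuclideanSpace.single a Complex.I
      = Complex.I • (EuclideanSpace.single a 1 : Cn n) := by
    ext i; simp
  rw [dzbar, hf.fderiv_restrictScalars ℝ, h1]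
  simp only [ContinuousLinearMap.coe_restrictScalars', map_smul, smul_eq_mul]
  linear_combination ((1/2 : ℂ) * fderiv ℂ f z (EuclideanSpace.single a 1)) * Complex.I_mul_I

theorem eq_sum_single (v : Cn n) :
    v = ∑ a, ((v a).re • EuclideanSpace.single a 1 +
      (v a).im • EuclideanSpace.single a Complex.I) := by
  ext i
  simp [Pi.single_apply, Finset.sum_add_distrib, Complex.re_add_im]

theorem fderiv_apply_eq (f : Cn n → ℂ) (z v : Cn n) :
    fderiv ℝ f z v = ∑ a, (dz a f z * v a + dzbar a f z * conj (v a)) := by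
  conv_lhs => rw [eq_sum_single v]
  rw [map_sum]
  refine Finset.sum_congr rfl fun a _ => ?_
  rw [map_add, map_smul, map_smul, Complex.real_smul, Complex.real_smul, dz, dzbar]
  conv_rhs => rw [← Complex.re_add_im (v a)]
  simp only [map_add, map_mul, Complex.conj_ofReal, Complex.conj_I]
  linear_combination (fderiv ℝ f z (EuclideanSpace.single a Complex.I) * (v a).im) * Complex.I_mul_I

/-- Cauchy–Riemann: without its `dz̄` part the real differential is complex linear. -/
theorem differentiableAt_of_dzbar_eq_zero {f : Cn n → ℂ} {z : Cn n} (hf : DifferentiableAt ℝ f z)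
    (h : ∀ a, dzbar a f z = 0) : DifferentiableAt ℂ f z := by
  rw [differentiableAt_iff_restrictScalars ℝ hf]
  let g : Cn n →L[ℂ] ℂ := ∑ a, dz a f z • (EuclideanSpace.proj a : Cn n →L[ℂ] ℂ)
  refine ⟨g, ?_⟩
  ext v
  rw [fderiv_apply_eq]
  simp [g, h]

theorem fderiv_eq_zero_of_dz_dzbar {f : Cn n → ℂ} {z : Cn n}
    (h : ∀ a, dz a f z = 0) (h' : ∀ a, dzbar a f z = 0) : fderiv ℝ f z = 0 := by
  ext v
  rw [fderiv_apply_eq]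
  simp [h, h']

/-! ### Matrix-valued functions -/

/-- Entrywise real differentiability of a matrix-valued function at a point. -/
def MatDiffAt (F : Cn n → Matrix (Fin n) (Fin n) ℂ) (z : Cn n) : Prop :=
  ∀ i j, DifferentiableAt ℝ (fun w => F w i j) z

variable {F H : Cn n → Matrix (Fin n) (Fin n) ℂ} {z : Cn n}

theorem mdz_mul (a : Fin n) (hF : MatDiffAt F z) (hH : MatDiffAt H z) :
    mdz a (fun w => F w * H w) z = mdz a F z * H z + F z * mdz a H z := by
  ext i j
  simp only [mdz, Matrix.of_apply, Matrix.mul_apply, Matrix.add_apply]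
  rw [dz_sum _ _ fun k _ => (hF i k).fun_mul (hH k j), ← Finset.sum_add_distrib]
  exact Finset.sum_congr rfl fun k _ => dz_mul a (hF i k) (hH k j)

theorem mdzbar_mul (a : Fin n) (hF : MatDiffAt F z) (hH : MatDiffAt H z) :
    mdzbar a (fun w => F w * H w) z = mdzbar a F z * H z + F z * mdzbar a H z := by
  ext i j
  simp only [mdzbar, Matrix.of_apply, Matrix.mul_apply, Matrix.add_apply]
  rw [dzbar_sum _ _ fun k _ => (hF i k).fun_mul (hH k j), ← Finset.sum_add_distrib]
  exact Finset.sum_congr rfl fun k _ => dzbar_mul a (hF i k) (hH k j)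

theorem mdzbar_conjTranspose (a : Fin n) (F : Cn n → Matrix (Fin n) (Fin n) ℂ) (z : Cn n) :
    mdzbar a (fun w => (F w)ᴴ) z = (mdz a F z)ᴴ := by
  ext i j
  exact dzbar_conj a (fun w => F w j i) z

theorem MatDiffAt.conjTranspose (hF : MatDiffAt F z) : MatDiffAt (fun w => (F w)ᴴ) z := by
  intro i j
  exact (hF j i).star

theorem mdzbar_congr {a : Fin n} (h : F =ᶠ[nhds z] H) : mdzbar a F z = mdzbar a H z := by
  ext i j
  exact dzbar_congr (h.mono fun w hw => by simp [hw])

theorem SmoothMatOn.matDiffAt {s : Set (Cn n)} (hF : SmoothMatOn F s) (hs : IsOpen s)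
    (hz : z ∈ s) : MatDiffAt F z := fun i j =>
  ((hF i j).contDiffAt (hs.mem_nhds hz)).differentiableAt (by simp)

theorem SmoothMatOn.mdz {s : Set (Cn n)} (hF : SmoothMatOn F s) (hs : IsOpen s) (a : Fin n) :
    SmoothMatOn (mdz a F) s := by
  intro i j
  have h1 : ContDiffOn ℝ ∞ (fderiv ℝ fun w => F w i j) s :=
    (hF i j).fderiv_of_isOpen hs (by simp)
  simp only [TTStar.mdz, Matrix.of_apply, dz]
  exact ((h1.clm_apply contDiffOn_const).sub
    (contDiffOn_const.mul (h1.clm_apply contDiffOn_const))).div_const 2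

theorem SmoothMatOn.mul {s : Set (Cn n)} (hF : SmoothMatOn F s) (hH : SmoothMatOn H s) :
    SmoothMatOn (fun w => F w * H w) s := by
  intro i j
  simp only [Matrix.mul_apply]
  exact ContDiffOn.sum fun k _ => (hF i k).mul (hH k j)

theorem SmoothMatOn.inv {F : Cn 2 → Matrix (Fin 2) (Fin 2) ℂ} {s : Set (Cn 2)}
    (hF : SmoothMatOn F s) (h0 : ∀ w ∈ s, (F w).det ≠ 0) : SmoothMatOn (fun w => (F w)⁻¹) s := by
  have hd : ContDiffOn ℝ ∞ (fun w => (F w).det⁻¹) s := by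
    refine ContDiffOn.inv ?_ h0
    simp only [Matrix.det_fin_two]
    exact ((hF 0 0).mul (hF 1 1)).sub ((hF 0 1).mul (hF 1 0))
  intro i j
  simp only [Matrix.inv_def, Ring.inverse_eq_inv', Matrix.adjugate_fin_two, Matrix.smul_apply,
    smul_eq_mul]
  refine hd.mul ?_
  fin_cases i <;> fin_cases j
  · exact hF 1 1
  · exact (hF 0 1).neg
  · exact (hF 1 0).neg
  · exact hF 0 0

/-! ### Algebra of `2 × 2` matrices -/

section Algebra

variable {N Q : Matrix (Fin 2) (Fin 2) ℂ}

/-- Cayley–Hamilton with the linear term gone. -/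
theorem mul_self_of_trace_eq_zero (ht : Q.trace = 0) : Q * Q = (-Q.det) • 1 := by
  rw [Matrix.trace_fin_two] at ht
  ext i j
  fin_cases i <;> fin_cases j <;>
    simp [Matrix.mul_apply, Fin.sum_univ_two, Matrix.det_fin_two]
  · linear_combination Q 0 0 * ht
  · linear_combination Q 0 1 * ht
  · linear_combination Q 1 0 * ht
  · linear_combination Q 1 1 * ht

/-- `Q²` is scalar, so `[N, Q²] = 0`. This commutator also equals `NQ + QN`, and half the sum of
that and `[N, Q] = N` is the claim. -/
theorem mul_eq_half_of_comm_eq (hc : comm N Q = N) (ht : Q.trace = 0) :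
    N * Q = (1 / 2 : ℂ) • N := by
  have hq := mul_self_of_trace_eq_zero ht
  have h1 : N * Q = Q * N + N := by
    rw [comm] at hc
    exact sub_eq_iff_eq_add'.mp hc
  have h2 : N * (Q * Q) = Q * Q * N + (Q * N + N * Q) := by
    rw [← mul_assoc, h1, add_mul, mul_assoc Q N Q, h1]
    noncomm_ring
  rw [hq] at h2
  simp only [Matrix.mul_smul, Matrix.smul_mul, mul_one, one_mul] at h2
  have h3 : Q * N + N * Q = 0 := by simpa using h2
  have h4 : (2 : ℂ) • (N * Q) = N := by
    rw [two_smul]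
    calc N * Q + N * Q = (Q * N + N * Q) + (N * Q - Q * N) := by abel
      _ = N := by rw [h3, zero_add]; exact hc
  rw [← h4, smul_smul]
  simp [h4]

/-- `NQ = N/2` and `QN = -N/2`, so bracketing `NQN` in two ways gives `N²/2 = -N²/2`. -/
theorem mul_self_eq_zero_of_comm_eq (hc : comm N Q = N) (ht : Q.trace = 0) : N * N = 0 := by
  have h1 := mul_eq_half_of_comm_eq hc ht
  have h2 : Q * N = -((1 / 2 : ℂ) • N) := by
    rw [comm, h1, sub_eq_iff_eq_add'] at hc
    rw [← sub_eq_iff_eq_add.mpr hc]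
    module
  have h3 : N * Q * N = N * (Q * N) := mul_assoc _ _ _
  rw [h1, h2] at h3
  simp only [Matrix.smul_mul, Matrix.mul_neg, Matrix.mul_smul] at h3
  have h4 : N * N = (1 / 2 : ℂ) • (N * N) + (1 / 2 : ℂ) • (N * N) := by module
  rw [h4]
  nth_rewrite 1 [h3]
  simp

theorem eq_zero_of_comm_eq (hc : comm N Q = N) (ht : Q.trace = 0)
    (hd : (Q - (1 / 2 : ℂ) • 1).det ≠ 0) : N = 0 := by
  have h1 : N * (Q - (1 / 2 : ℂ) • 1) = 0 := by
    rw [mul_sub, mul_eq_half_of_comm_eq hc ht]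
    simp
  have h2 : IsUnit (Q - (1 / 2 : ℂ) • 1) := (Matrix.isUnit_iff_isUnit_det _).mpr hd.isUnit
  exact h2.mul_left_eq_zero.mp h1

/-- Normal and nilpotent implies zero, for the inner product with Gram matrix `G`. With `N† = G⁻¹ Nᴴ
G`, the operator `N†N` is self-adjoint and, by normality, its square contains the factor `N²`; so
`N†N = 0`, and definiteness then kills `N`. -/
theorem eq_zero_of_normal_of_sq_eq_zero {n : ℕ} {N G : Matrix (Fin n) (Fin n) ℂ}
    (hG : Gᴴ = G) (hGd : G.det ≠ 0)
    (hpos : ∀ x, star x ⬝ᵥ G *ᵥ x = 0 → x = 0) (hN : N * N = 0)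
    (hc : comm N (G⁻¹ * Nᴴ * G) = 0) : N = 0 := by
  -- The matrix form of: `h(Bx, Bx) = 0` for all `x` forces `B = 0`. It is applied to `N†N` and then
  -- to `N`.
  have key : ∀ B : Matrix (Fin n) (Fin n) ℂ, Bᴴ * G * B = 0 → B = 0 := by
    intro B hB
    have h1 : ∀ x, B *ᵥ x = 0 := by
      intro x
      apply hpos
      rw [Matrix.star_mulVec, ← Matrix.dotProduct_mulVec, Matrix.mulVec_mulVec,
        Matrix.mulVec_mulVec, hB]
      simp
    ext i j
    have := congrFun (h1 (Pi.single j 1)) i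
    simpa using this
  have hu : IsUnit G.det := hGd.isUnit
  have hcomm : N * (G⁻¹ * Nᴴ * G) = G⁻¹ * Nᴴ * G * N := sub_eq_zero.mp hc
  have h1 : G⁻¹ * Nᴴ * G * N = 0 := by
    apply key
    have h2 : (G⁻¹ * Nᴴ * G * N)ᴴ * G = Nᴴ * G * N := by
      simp only [Matrix.conjTranspose_mul, Matrix.conjTranspose_nonsing_inv, hG,
        Matrix.conjTranspose_conjTranspose]
      simp only [mul_assoc, Matrix.nonsing_inv_mul _ hu, mul_one]
    rw [h2, ← hcomm]
    calc Nᴴ * G * N * (N * (G⁻¹ * Nᴴ * G)) = Nᴴ * G * (N * N) * (G⁻¹ * Nᴴ * G) := by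
          noncomm_ring
      _ = 0 := by rw [hN]; simp
  apply key
  have h3 : G * (G⁻¹ * Nᴴ * G * N) = Nᴴ * G * N := by
    simp only [← mul_assoc, Matrix.mul_nonsing_inv _ hu, one_mul]
  rw [← h3, h1, mul_zero]

end Algebra

/-! ### Coordinates on the fibres -/

section Fibre

variable {n : ℕ} {M : Type*} [TopologicalSpace M] [ChartedSpace (Cn n) M]

/-- The tangent vector at `e⁻¹(z)` with components `c` in the chart `e`. -/
def lift (e : OpenPartialHomeomorph M (Cn n)) (z : Cn n) (c : Cn n) :
    TangentSpace 𝓘(ℂ, Cn n) (e.symm z) :=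
  mfderiv 𝓘(ℂ, Cn n) 𝓘(ℂ, Cn n) e.symm z c

theorem lift_eq_sum (e : OpenPartialHomeomorph M (Cn n)) (z c : Cn n) :
    lift e z c = ∑ i, c i • coordVec e z i := by
  have h : c = ∑ i, c i • (EuclideanSpace.single i (1 : ℂ) : Cn n) := by
    ext k; simp [Pi.single_apply]
  have h2 := congrArg (mfderiv 𝓘(ℂ, Cn n) 𝓘(ℂ, Cn n) e.symm z) h
  rw [lift, h2]
  exact (map_sum (mfderiv 𝓘(ℂ, Cn n) 𝓘(ℂ, Cn n) e.symm z) _ _).trans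
    (Finset.sum_congr rfl fun i _ =>
      map_smul (mfderiv 𝓘(ℂ, Cn n) 𝓘(ℂ, Cn n) e.symm z) (c i) _)

variable {e : OpenPartialHomeomorph M (Cn n)} {z : Cn n}

theorem comp_sum {ι : Type*} (s : Finset ι) (e : OpenPartialHomeomorph M (Cn n)) (z : Cn n)
    (c : ι → ℂ) (v : ι → TangentSpace 𝓘(ℂ, Cn n) (e.symm z)) (k : Fin n) :
    comp e z (∑ i ∈ s, c i • v i) k = ∑ i ∈ s, c i * comp e z (v i) k := by
  have h : comp e z (∑ i ∈ s, c i • v i) = ∑ i ∈ s, c i • comp e z (v i) :=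
    (map_sum (mfderiv 𝓘(ℂ, Cn n) 𝓘(ℂ, Cn n) e (e.symm z)) _ _).trans
    (Finset.sum_congr rfl fun i _ =>
      map_smul (mfderiv 𝓘(ℂ, Cn n) 𝓘(ℂ, Cn n) e (e.symm z)) (c i) _)
  rw [h]
  simp

theorem comp_end_lift (A : EndField n M) (c : Cn n) (k : Fin n) :
    comp e z (A (e.symm z) (lift e z c)) k = (endMat e A z *ᵥ c) k := by
  rw [lift_eq_sum, map_sum]
  simp only [map_smul]
  rw [comp_sum]
  simp only [Matrix.mulVec, dotProduct, endMat, Matrix.of_apply, mul_comm]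

theorem lift_single (i : Fin n) : lift e z (EuclideanSpace.single i 1) = coordVec e z i := rfl

theorem sesq_lift_lift (h : SesqField n M) (c d : Cn n) :
    h (e.symm z) (lift e z c) (lift e z d) = star (d : Fin n → ℂ) ⬝ᵥ gram e h z *ᵥ c := by
  rw [lift_eq_sum, lift_eq_sum]
  simp only [map_sum, map_smul, LinearMap.sum_apply, LinearMap.smul_apply, LinearMap.map_smulₛₗ,
    Matrix.mulVec, dotProduct, gram, Matrix.of_apply, smul_eq_mul, Finset.mul_sum, Pi.star_apply]
  refine Finset.sum_congr rfl fun i _ => Finset.sum_congr rfl fun j _ => ?_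
  simp
  exact Or.inl (mul_comm _ _)

theorem IsHermitian.gram_conjTranspose {h : SesqField n M} (hh : IsHermitian h) :
    (gram e h z)ᴴ = gram e h z := by
  ext i j
  simp only [Matrix.conjTranspose_apply, gram, Matrix.of_apply]
  exact (hh.herm _ _ _).symm

theorem higgsMat_eq_zero {Φ : HiggsField n M} (h0 : Φ (e.symm z) = 0) (a : Fin n) :
    higgsMat e Φ a z = 0 := by
  ext k j
  simp only [higgsMat, h0, Matrix.of_apply, LinearMap.zero_apply, Matrix.zero_apply]
  have : comp e z 0 = 0 := map_zero (mfderiv 𝓘(ℂ, Cn n) 𝓘(ℂ, Cn n) e (e.symm z))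
  rw [this]
  rfl

variable [IsManifold 𝓘(ℂ, Cn n) ω M]

theorem mdifferentiable_chart_of_mem_atlas (he : e ∈ atlas (Cn n) M) :
    e.MDifferentiable 𝓘(ℂ, Cn n) 𝓘(ℂ, Cn n) :=
  haveI : IsManifold 𝓘(ℂ, Cn n) 1 M := IsManifold.of_le (n := ω) le_top
  mdifferentiable_of_mem_atlas he

/-- With `lift_comp`, this makes `comp` and `lift` mutually inverse, so conditions on the fibres of
`T_M` turn into matrix identities. -/
theorem comp_lift (he : e ∈ atlas (Cn n) M) (hz : z ∈ e.target) (c : Cn n) :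
    comp e z (lift e z c) = c :=
  DFunLike.congr_fun ((mdifferentiable_chart_of_mem_atlas he).comp_symm_deriv hz) c

theorem lift_comp (he : e ∈ atlas (Cn n) M) (hz : z ∈ e.target)
    (v : TangentSpace 𝓘(ℂ, Cn n) (e.symm z)) : lift e z (comp e z v) = v := by
  have h := (mdifferentiable_chart_of_mem_atlas he).symm_comp_deriv (e.map_target hz)
  have h2 := DFunLike.congr_fun h v
  have h3 : e (e.symm z) = z := e.right_inv hz
  rw [ContinuousLinearMap.comp_apply] at h2
  rw [h3] at h2
  exact h2

theorem end_lift (A : EndField n M) (he : e ∈ atlas (Cn n) M) (hz : z ∈ e.target) (c : Cn n) :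
    A (e.symm z) (lift e z c) = lift e z (WithLp.toLp 2 (endMat e A z *ᵥ c)) := by
  rw [← lift_comp he hz (A (e.symm z) (lift e z c))]
  congr 1
  ext k
  exact comp_end_lift A c k

variable {h : SesqField n M}

theorem lift_eq_zero (he : e ∈ atlas (Cn n) M) (hz : z ∈ e.target) {c : Cn n}
    (hc : lift e z c = 0) : c = 0 := by
  rw [← comp_lift he hz c, hc]
  exact map_zero (mfderiv 𝓘(ℂ, Cn n) 𝓘(ℂ, Cn n) e (e.symm z))

theorem PosDef.gram_definite (hpos : PosDef h) (he : e ∈ atlas (Cn n) M) (hz : z ∈ e.target)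
    (x : Fin n → ℂ) (hx : star x ⬝ᵥ gram e h z *ᵥ x = 0) : x = 0 := by
  have h1 := sesq_lift_lift (e := e) (z := z) h (WithLp.toLp 2 x) (WithLp.toLp 2 x)
  by_contra hne
  have h2 : lift e z (WithLp.toLp 2 x) ≠ 0 := fun h0 => hne <| by
    have := lift_eq_zero he hz h0
    simpa using this
  have h3 := hpos _ _ h2
  rw [h1] at h3
  simp [hx] at h3

theorem IsHermitian.gram_det_ne_zero (hh : IsHermitian h) (he : e ∈ atlas (Cn n) M)
    (hz : z ∈ e.target) : (gram e h z).det ≠ 0 := by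
  intro h0
  obtain ⟨v, hv, hv0⟩ := Matrix.exists_mulVec_eq_zero_iff.mpr h0
  apply hv
  have h2 : lift e z (WithLp.toLp 2 v) = 0 := by
    refine hh.nondeg _ _ fun w => ?_
    rw [← lift_comp he hz w, sesq_lift_lift]
    simp [hv0]
  have := lift_eq_zero he hz h2
  simpa using this

theorem higgs_eq_zero {Φ : HiggsField n M} (he : e ∈ atlas (Cn n) M) (hz : z ∈ e.target)
    (h0 : ∀ a, higgsMat e Φ a z = 0) : Φ (e.symm z) = 0 := by
  have h1 : ∀ a j, Φ (e.symm z) (coordVec e z a) (coordVec e z j) = 0 := by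
    intro a j
    rw [← lift_comp he hz (Φ (e.symm z) (coordVec e z a) (coordVec e z j))]
    have : comp e z (Φ (e.symm z) (coordVec e z a) (coordVec e z j)) = 0 := by
      ext k
      have := congrFun (congrFun (h0 a) k) j
      simpa [higgsMat] using this
    rw [this]
    exact map_zero (mfderiv 𝓘(ℂ, Cn n) 𝓘(ℂ, Cn n) e.symm z)
  ext v w
  rw [← lift_comp he hz v, ← lift_comp he hz w, lift_eq_sum, lift_eq_sum]
  simp [h1, LinearMap.sum_apply]

/-- `B` below is the matrix of the bilinear form `g`. Skewness of `Q` for `g` reads `B Q = -Qᵀ B`,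
and `B` is invertible because `h` is non-degenerate and `κ` is onto. So `Q` is similar to `-Qᵀ` and
its trace equals its own negative. -/
theorem trace_endMat_eq_zero {κ : AntiField n M} {Q : EndField n M} (hh : IsHermitian h)
    (hκ : ∀ x v, κ x (κ x v) = v)
    (hQ : ∀ x v w, h x (Q x v) (κ x w) + h x v (κ x (Q x w)) = 0)
    (he : e ∈ atlas (Cn n) M) (hz : z ∈ e.target) : (endMat e Q z).trace = 0 := by
  let B : Matrix (Fin n) (Fin n) ℂ :=
    Matrix.of fun i j => h (e.symm z) (coordVec e z j) (κ (e.symm z) (coordVec e z i))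
  have hB : ∀ c d : Cn n, h (e.symm z) (lift e z c) (κ (e.symm z) (lift e z d))
      = (d : Fin n → ℂ) ⬝ᵥ B *ᵥ c := by
    intro c d
    rw [lift_eq_sum, lift_eq_sum]
    simp only [map_sum, map_smul, LinearMap.sum_apply, LinearMap.smul_apply, LinearMap.map_smulₛₗ,
      Matrix.mulVec, dotProduct, B, Matrix.of_apply, smul_eq_mul, Finset.mul_sum]
    refine Finset.sum_congr rfl fun i _ => Finset.sum_congr rfl fun j _ => ?_
    simp
    exact Or.inl (mul_comm _ _)
  have hdet : B.det ≠ 0 := by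
    intro h0
    obtain ⟨v, hv, hv0⟩ := Matrix.exists_mulVec_eq_zero_iff.mpr h0
    apply hv
    have h2 : lift e z (WithLp.toLp 2 v) = 0 := by
      refine hh.nondeg _ _ fun w => ?_
      rw [← hκ _ w, ← lift_comp he hz (κ _ w), hB]
      simp [hv0]
    have := lift_eq_zero he hz h2
    simpa using this
  have hrel : B * endMat e Q z = -((endMat e Q z)ᵀ * B) := by
    rw [eq_neg_iff_add_eq_zero]
    ext i j
    have := hQ (e.symm z) (lift e z (EuclideanSpace.single j 1))
      (lift e z (EuclideanSpace.single i 1))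
    rw [end_lift Q he hz, end_lift Q he hz, hB, hB] at this
    simp only [PiLp.ofLp_single, Matrix.mulVec_single_one] at this
    rw [single_one_dotProduct] at this
    simpa [Matrix.mulVec, dotProduct, Matrix.mul_apply] using this
  have hconj : endMat e Q z = -(B⁻¹ * ((endMat e Q z)ᵀ * B)) := by
    rw [← Matrix.mul_neg, ← hrel, ← mul_assoc, Matrix.nonsing_inv_mul _ hdet.isUnit, one_mul]
  have ht : (endMat e Q z).trace = -(endMat e Q z).trace := by
    conv_lhs => rw [hconj]
    rw [Matrix.trace_neg, Matrix.trace_mul_comm, mul_assoc, Matrix.mul_nonsing_inv _ hdet.isUnit,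
      mul_one, Matrix.trace_transpose]
  linear_combination ht / 2

end Fibre

/-! ### Flat sections of line subbundles -/

theorem fderiv_eq_sum {n : ℕ} {f : Cn n → ℂ} {z : Cn n} (hf : DifferentiableAt ℂ f z) (v : Cn n) :
    fderiv ℂ f z v = ∑ a, dz a f z * v a := by
  have h1 := fderiv_apply_eq f z v
  rw [hf.fderiv_restrictScalars ℝ] at h1
  simpa [dzbar_of_complex _ hf] using h1

/-- A closed holomorphic `1`-form on an open convex set has a holomorphic primitive. -/
theorem exists_primitive {n : ℕ} {s : Set (Cn n)} (hs : Convex ℝ s) (hso : IsOpen s)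
    {η : Fin n → Cn n → ℂ} (hη : ∀ a, DifferentiableOn ℂ (η a) s)
    (hclosed : ∀ z ∈ s, ∀ a b, dz a (η b) z = dz b (η a) z) :
    ∃ γ : Cn n → ℂ, ∀ z ∈ s, DifferentiableAt ℂ γ z ∧ ∀ a, dz a γ z = η a z := by
  let θ : Cn n → Cn n →L[ℂ] ℂ := fun z => ∑ a, η a z • (EuclideanSpace.proj a : Cn n →L[ℂ] ℂ)
  have hη' : ∀ z ∈ s, ∀ a, DifferentiableAt ℂ (η a) z := fun z hz a =>
    (hη a).differentiableAt (hso.mem_nhds hz)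
  have hθ : ∀ z ∈ s, HasFDerivAt θ
      (∑ a, (fderiv ℂ (η a) z).smulRight (EuclideanSpace.proj a : Cn n →L[ℂ] ℂ)) z := by
    intro z hz
    exact HasFDerivAt.fun_sum fun a _ => (hη' z hz a).hasFDerivAt.smul_const
      (EuclideanSpace.proj a : Cn n →L[ℂ] ℂ)
  have hθ' : ∀ z ∈ s, HasFDerivWithinAt θ ((∑ a, (fderiv ℂ (η a) z).smulRight
      (EuclideanSpace.proj a : Cn n →L[ℂ] ℂ)).restrictScalars ℝ) s z := fun z hz =>
    ((hθ z hz).restrictScalars ℝ).hasFDerivWithinAt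
  -- Poincaré lemma on a convex set: closedness of `η` is exactly the symmetry of the derivative of
  -- `θ = ∑ ηₐ dzᵃ`.
  obtain ⟨γ, hγ⟩ := hs.exists_forall_hasFDerivWithinAt_of_hasFDerivWithinAt_symmetric hθ' (by
      intro z hz x _ y _
      simp only [ContinuousLinearMap.coe_restrictScalars', sum_apply,
        ContinuousLinearMap.smulRight_apply, smul_apply, PiLp.proj_apply, smul_eq_mul,
        fderiv_eq_sum (hη' z hz _), Finset.sum_mul]
      rw [Finset.sum_comm]
      refine Finset.sum_congr rfl fun a _ => Finset.sum_congr rfl fun b _ => ?_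
      rw [hclosed z hz a b]
      ring)
  refine ⟨γ, fun z hz => ?_⟩
  have h1 := (hγ z hz).hasFDerivAt (hso.mem_nhds hz)
  refine ⟨h1.differentiableAt, fun a => ?_⟩
  rw [dz_of_complex a h1.differentiableAt, h1.fderiv]
  simp [θ]

theorem differentiableAt_div {n : ℕ} {f g : Cn n → ℂ} {z : Cn n} (hf : DifferentiableAt ℂ f z)
    (hg : DifferentiableAt ℂ g z) (h0 : g z ≠ 0) : DifferentiableAt ℂ (fun w => f w / g w) z := by
  simp only [div_eq_mul_inv]
  exact hf.fun_mul (hg.fun_inv h0)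

theorem dz_div {n : ℕ} (a : Fin n) {f g : Cn n → ℂ} {z : Cn n} (hf : DifferentiableAt ℂ f z)
    (hg : DifferentiableAt ℂ g z) (h0 : g z ≠ 0) :
    dz a (fun w => f w / g w) z = (dz a f z * g z - f z * dz a g z) / g z ^ 2 := by
  have h1 : dz a f z = dz a (fun w => f w / g w * g w) z :=
    dz_congr ((hg.continuousAt.eventually_ne h0).mono fun w hw => (div_mul_cancel₀ _ hw).symm)
  rw [dz_mul a ((differentiableAt_div hf hg h0).restrictScalars ℝ) (hg.restrictScalars ℝ)] at h1
  rw [h1]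
  field_simp
  ring

theorem dz_exp_neg {n : ℕ} (a : Fin n) {f : Cn n → ℂ} {z : Cn n} (hf : DifferentiableAt ℂ f z) :
    dz a (fun w => Complex.exp (-f w)) z = -(dz a f z * Complex.exp (-f z)) := by
  have h1 : HasFDerivAt (fun w => Complex.exp (-f w)) _ z := hf.hasFDerivAt.fun_neg.cexp
  rw [dz_of_complex a hf, dz_of_complex a h1.differentiableAt, h1.fderiv]
  simp
  ring

theorem MatDiffAt.of_complex {n : ℕ} {F : Cn n → Matrix (Fin n) (Fin n) ℂ} {z : Cn n}
    (h : ∀ i j, DifferentiableAt ℂ (fun w => F w i j) z) : MatDiffAt F z :=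
  fun i j => (h i j).restrictScalars ℝ

/-- The columns of `P * B` and of `P` lie in the image of `P`, which is at most a line; the identity
is the vanishing of their 2 × 2 minors. -/
theorem mul_col_eq {P : Matrix (Fin 2) (Fin 2) ℂ} (hP : P.det = 0) (B : Matrix (Fin 2) (Fin 2) ℂ)
    (k l j : Fin 2) : (P * B) l j * P k j = (P * B) k j * P l j := by
  rw [Matrix.det_fin_two] at hP
  fin_cases k <;> fin_cases l <;> fin_cases j <;>
    simp [Matrix.mul_apply, Fin.sum_univ_two]
  · linear_combination B 1 0 * hP
  · linear_combination -B 0 1 * hP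
  · linear_combination -B 1 0 * hP
  · linear_combination B 0 1 * hP

/-- A parallel field `P` of endomorphisms of rank one, for a flat holomorphic connection
`d + ∑ A_a dzᵃ`, has locally a flat holomorphic section in its image. -/
theorem exists_flat_section {Ω : Set (Cn 2)} (hΩ : IsOpen Ω)
    {A : Fin 2 → Cn 2 → Matrix (Fin 2) (Fin 2) ℂ} {P : Cn 2 → Matrix (Fin 2) (Fin 2) ℂ}
    (hA : ∀ z ∈ Ω, ∀ a i j, DifferentiableAt ℂ (fun w => A a w i j) z)
    (hP : ∀ z ∈ Ω, ∀ i j, DifferentiableAt ℂ (fun w => P w i j) z)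
    (hcurv : ∀ z ∈ Ω, ∀ a b, mdz a (A b) z - mdz b (A a) z + comm (A a z) (A b z) = 0)
    (hPA : ∀ z ∈ Ω, ∀ a, mdz a P z + comm (A a z) (P z) = 0)
    (hdet : ∀ z ∈ Ω, (P z).det = 0) {z₀ : Cn 2} (hz₀ : z₀ ∈ Ω) (hP₀ : P z₀ ≠ 0) :
    ∃ r > 0, Metric.ball z₀ r ⊆ Ω ∧ ∃ (u : Cn 2 → Cn 2) (c : Cn 2 → ℂ) (j : Fin 2),
      ∀ z ∈ Metric.ball z₀ r, u z ≠ 0 ∧ (∀ i, u z i = c z * P z i j) ∧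
        (∀ i, DifferentiableAt ℂ (fun w => u w i) z) ∧
        ∀ a i, dz a (fun w => u w i) z + ∑ l, A a z i l * u z l = 0 := by
  obtain ⟨k, j, hkj⟩ : ∃ k j, P z₀ k j ≠ 0 := by
    by_contra! hcon
    exact hP₀ (Matrix.ext hcon)
  have hnear : ∀ᶠ z in nhds z₀, z ∈ Ω ∧ P z k j ≠ 0 :=
    Filter.Eventually.and (hΩ.mem_nhds hz₀) ((hP z₀ hz₀ k j).continuousAt.eventually_ne hkj)
  obtain ⟨r, hr, hball⟩ := Metric.eventually_nhds_iff_ball.mp hnear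
  have hPB : ∀ z ∈ Ω, ∀ a i l, DifferentiableAt ℂ (fun w => (P w * A a w) i l) z := by
    intro z hz a i l
    simp only [Matrix.mul_apply]
    exact DifferentiableAt.fun_sum fun m _ => (hP z hz i m).fun_mul (hA z hz a m l)
  -- Parallelism gives `∂ₐP = P Aₐ - Aₐ P`, so the covariant derivative of column `j` of `P` is
  -- column `j` of `P Aₐ`. By rank one this is a multiple of column `j` of `P`; `η a` is the factor,
  -- read off in row `k` where `P k j ≠ 0`.
  let η : Fin 2 → Cn 2 → ℂ := fun a z => (P z * A a z) k j / P z k j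
  have hdP : ∀ z ∈ Ω, ∀ a i l, dz a (fun w => P w i l) z
      = (P z * A a z) i l - (A a z * P z) i l := by
    intro z hz a i l
    have := congrFun (congrFun (hPA z hz a) i) l
    simp only [comm, Matrix.add_apply, Matrix.sub_apply, mdz, Matrix.of_apply,
      Matrix.zero_apply] at this
    linear_combination this
  have hdPB : ∀ z ∈ Ω, ∀ a b, dz a (fun w => (P w * A b w) k j) z
      = ((P z * A a z - A a z * P z) * A b z + P z * mdz a (A b) z) k j := by
    intro z hz a b
    have h1 : mdz a P z = P z * A a z - A a z * P z := by
      ext i l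
      exact hdP z hz a i l
    rw [← h1, ← mdz_mul a (.of_complex (hP z hz)) (.of_complex (hA z hz b))]
    rfl
  -- `η` is the connection form induced on the line spanned by column `j`; it is closed because the
  -- ambient connection is flat.
  have hclosed : ∀ z ∈ Metric.ball z₀ r, ∀ a b, dz a (η b) z = dz b (η a) z := by
    intro z hz a b
    obtain ⟨hzΩ, h0⟩ := hball z hz
    rw [dz_div a (hPB z hzΩ b k j) (hP z hzΩ k j) h0, dz_div b (hPB z hzΩ a k j) (hP z hzΩ k j) h0]
    congr 1
    rw [hdPB z hzΩ, hdPB z hzΩ, hdP z hzΩ, hdP z hzΩ]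
    have hA1 : ∀ a b, (A a z * P z * A b z) k j * P z k j
        = (P z * A b z) k j * (A a z * P z) k j := by
      intro a b
      rw [mul_assoc, Matrix.mul_apply, Matrix.mul_apply (M := A a z) (N := P z), Finset.sum_mul,
        Finset.mul_sum]
      refine Finset.sum_congr rfl fun m _ => ?_
      linear_combination A a z k m * mul_col_eq (hdet z hzΩ) (A b z) k m j
    have hc : (P z * (mdz a (A b) z - mdz b (A a) z + comm (A a z) (A b z))) k j = 0 := by
      rw [hcurv z hzΩ]
      simp
    simp only [comm, mul_add, mul_sub, sub_mul, Matrix.add_apply, Matrix.sub_apply,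
      ← mul_assoc] at hc ⊢
    linear_combination P z k j * hc - hA1 a b + hA1 b a
  obtain ⟨γ, hγ⟩ := exists_primitive (convex_ball z₀ r) Metric.isOpen_ball
    (fun a z hz => (differentiableAt_div (hPB z (hball z hz).1 a k j)
      (hP z (hball z hz).1 k j) (hball z hz).2).differentiableWithinAt) hclosed
  refine ⟨r, hr, fun z hz => (hball z hz).1,
    -- The factor `exp (-γ)`, with `dγ = η`, cancels the covariant derivative of the column.
    fun z => WithLp.toLp 2 fun i => Complex.exp (-γ z) * P z i j, fun z => Complex.exp (-γ z), j,
    fun z hz => ?_⟩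
  obtain ⟨hzΩ, h0⟩ := hball z hz
  obtain ⟨hγd, hγz⟩ := hγ z hz
  have hexp : DifferentiableAt ℂ (fun w => Complex.exp (-γ w)) z := hγd.fun_neg.cexp
  refine ⟨fun h => ?_, fun i => rfl, fun i => hexp.fun_mul (hP z hzΩ i j), fun a i => ?_⟩
  · have := congrFun (congrArg WithLp.ofLp h) k
    simp [h0, Complex.exp_ne_zero] at this
  · have hη : η a z * P z i j = (P z * A a z) i j := by
      simp only [η]
      field_simp
      linear_combination -mul_col_eq (hdet z hzΩ) (A a z) k i j
    simp only
    rw [dz_mul a (hexp.restrictScalars ℝ) ((hP z hzΩ i j).restrictScalars ℝ), dz_exp_neg a hγd,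
      hγz a, hdP z hzΩ]
    have hs : ∑ l, A a z i l * (Complex.exp (-γ z) * P z l j)
        = Complex.exp (-γ z) * (A a z * P z) i j := by
      rw [Matrix.mul_apply, Finset.mul_sum]
      exact Finset.sum_congr rfl fun l _ => by ring
    rw [hs]
    linear_combination -Complex.exp (-γ z) * hη

/-! ### The Chern connection in a chart -/

theorem dz_sub {n : ℕ} (a : Fin n) {f g : Cn n → ℂ} {z : Cn n} (hf : DifferentiableAt ℝ f z)
    (hg : DifferentiableAt ℝ g z) :
    dz a (fun w => f w - g w) z = dz a f z - dz a g z := by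
  simp only [dz, fderiv_fun_sub hf hg, sub_apply]
  ring

section Chern

variable {n : ℕ} {M : Type*} [TopologicalSpace M] [ChartedSpace (Cn n) M]
  [IsManifold 𝓘(ℂ, Cn n) ω M] {e : OpenPartialHomeomorph M (Cn n)} {z : Cn n} {h : SesqField n M}

theorem IsHermitian.gram_mul_chern (hh : IsHermitian h) (he : e ∈ atlas (Cn n) M)
    (hz : z ∈ e.target) (a : Fin n) : gram e h z * chern e h a z = mdz a (gram e h) z := by
  rw [chern, ← mul_assoc, Matrix.mul_nonsing_inv _ (hh.gram_det_ne_zero he hz).isUnit, one_mul]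

theorem gram_mul_endMat {Q : EndField n M} (hQ : ∀ x v w, h x (Q x v) w = h x v (Q x w))
    (he : e ∈ atlas (Cn n) M) (hz : z ∈ e.target) :
    gram e h z * endMat e Q z = (endMat e Q z)ᴴ * gram e h z := by
  ext i j
  have := hQ (e.symm z) (lift e z (EuclideanSpace.single j 1))
      (lift e z (EuclideanSpace.single i 1))
  rw [end_lift Q he hz, end_lift Q he hz, sesq_lift_lift, sesq_lift_lift] at this
  simp only [PiLp.ofLp_single, Matrix.mulVec_single_one] at this
  rw [← Pi.single_star, star_one, single_one_dotProduct] at this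
  simpa [Matrix.mulVec, dotProduct, Matrix.mul_apply] using this

/-- A self-adjoint endomorphism with `D'(Q) = 0` is holomorphic. -/
theorem mdzbar_endMat_eq_zero {Q : EndField n M} (hh : IsHermitian h)
    (hQ : ∀ x v w, h x (Q x v) w = h x v (Q x w)) (he : e ∈ atlas (Cn n) M)
    (hQs : SmoothMatOn (endMat e Q) e.target) (hz : z ∈ e.target) (a : Fin n)
    (hD : chernEnd e h a (endMat e Q) z = 0) : mdzbar a (endMat e Q) z = 0 := by
  have hGd := (hh.smooth e he).matDiffAt e.open_target hz
  have hQd := hQs.matDiffAt e.open_target hz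
  -- Apply `∂̄` to `G Q = Qᴴ G`, using `∂̄G = Aᴴ G` and `∂̄(Qᴴ) = (∂Q)ᴴ = (QA - AQ)ᴴ`. All terms
  -- cancel except `G ∂̄Q`.
  have h1 : mdzbar a (fun w => gram e h w * endMat e Q w) z
      = mdzbar a (fun w => (endMat e Q w)ᴴ * gram e h w) z :=
    mdzbar_congr (Filter.mem_of_superset (e.open_target.mem_nhds hz)
      fun w hw => gram_mul_endMat hQ he hw)
  rw [mdzbar_mul a hGd hQd, mdzbar_mul a hQd.conjTranspose hGd, mdzbar_conjTranspose] at h1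
  have h2 : mdzbar a (gram e h) z = (chern e h a z)ᴴ * gram e h z := by
    have h3 : gram e h = fun w => (gram e h w)ᴴ := by
      funext w
      exact hh.gram_conjTranspose.symm
    conv_lhs => rw [h3]
    rw [mdzbar_conjTranspose, ← hh.gram_mul_chern he hz, Matrix.conjTranspose_mul,
      hh.gram_conjTranspose]
  have h4 : mdz a (endMat e Q) z = endMat e Q z * chern e h a z - chern e h a z * endMat e Q z := by
    rw [chernEnd, comm] at hD
    rw [eq_sub_iff_add_eq, ← sub_eq_zero, ← hD]
    abel
  rw [h2, h4, Matrix.conjTranspose_sub, Matrix.conjTranspose_mul, Matrix.conjTranspose_mul,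
    mul_assoc, gram_mul_endMat hQ he hz, sub_mul] at h1
  have h5 : gram e h z * mdzbar a (endMat e Q) z = 0 := by
    have h6 := congrArg (fun B => B - (chern e h a z)ᴴ * ((endMat e Q z)ᴴ * gram e h z)) h1
    simp only [add_sub_cancel_left] at h6
    rw [h6]
    noncomm_ring
  exact ((Matrix.isUnit_iff_isUnit_det _).mpr
    (hh.gram_det_ne_zero he hz).isUnit).mul_right_eq_zero.mp h5

end Chern

/-! ### Holomorphic connection matrices and parallel endomorphisms in dimension two -/

section DimTwo

variable {M : Type*} [TopologicalSpace M] [ChartedSpace (Cn 2) M]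
  [IsManifold 𝓘(ℂ, Cn 2) ω M] {e : OpenPartialHomeomorph M (Cn 2)} {z : Cn 2} {h : SesqField 2 M}

theorem IsHermitian.smooth_inv_gram (hh : IsHermitian h) (he : e ∈ atlas (Cn 2) M) :
    SmoothMatOn (fun w => (gram e h w)⁻¹) e.target :=
  (hh.smooth e he).inv fun _ hw => hh.gram_det_ne_zero he hw

theorem IsHermitian.smooth_chern (hh : IsHermitian h) (he : e ∈ atlas (Cn 2) M) (a : Fin 2) :
    SmoothMatOn (chern e h a) e.target :=
  (hh.smooth_inv_gram he).mul ((hh.smooth e he).mdz e.open_target a)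

theorem differentiableAt_of_mdzbar {n : ℕ} {F : Cn n → Matrix (Fin n) (Fin n) ℂ} {z : Cn n}
    (hF : MatDiffAt F z) (h0 : ∀ a, mdzbar a F z = 0) (i j : Fin n) :
    DifferentiableAt ℂ (fun w => F w i j) z :=
  differentiableAt_of_dzbar_eq_zero (hF i j) fun a => congrFun (congrFun (h0 a) i) j

/-- The determinant of a parallel holomorphic endomorphism is locally constant. -/
theorem det_eq_of_parallel {s : Set (Cn 2)} (hs : Convex ℝ s) (hso : IsOpen s)
    {A : Fin 2 → Cn 2 → Matrix (Fin 2) (Fin 2) ℂ} {F : Cn 2 → Matrix (Fin 2) (Fin 2) ℂ}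
    (hF : ∀ z ∈ s, ∀ i j, DifferentiableAt ℂ (fun w => F w i j) z)
    (hA : ∀ z ∈ s, ∀ a, mdz a F z + comm (A a z) (F z) = 0) {z w : Cn 2} (hz : z ∈ s)
    (hw : w ∈ s) : (F z).det = (F w).det := by
  have hd : ∀ x ∈ s, DifferentiableAt ℂ (fun w => (F w).det) x := by
    intro x hx
    simp only [Matrix.det_fin_two]
    exact ((hF x hx 0 0).fun_mul (hF x hx 1 1)).fun_sub ((hF x hx 0 1).fun_mul (hF x hx 1 0))
  refine hs.is_const_of_fderivWithin_eq_zero (𝕜 := ℝ) (f := fun w => (F w).det)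
    (fun x hx => ((hd x hx).restrictScalars ℝ).differentiableWithinAt) (fun x hx => ?_) hz hw
  rw [fderivWithin_of_isOpen hso hx]
  refine fderiv_eq_zero_of_dz_dzbar (fun a => ?_) fun a => dzbar_of_complex a (hd x hx)
  have hr := fun i j => (hF x hx i j).restrictScalars ℝ
  simp only [Matrix.det_fin_two]
  rw [dz_sub a ((hr 0 0).fun_mul (hr 1 1)) ((hr 0 1).fun_mul (hr 1 0)), dz_mul a (hr 0 0) (hr 1 1),
    dz_mul a (hr 0 1) (hr 1 0)]
  have hAx := fun i j => congrFun (congrFun (hA x hx a) i) j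
  simp only [comm, Matrix.add_apply, Matrix.sub_apply, mdz, Matrix.of_apply, Matrix.zero_apply,
    Matrix.mul_apply, Fin.sum_univ_two] at hAx
  -- Jacobi's formula: the coefficients are the cofactors of `F`. The derivative of the determinant
  -- is `tr (adj F · [F, A])`, which vanishes because `adj F` commutes with `F`.
  linear_combination F x 1 1 * hAx 0 0 + F x 0 0 * hAx 1 1 - F x 1 0 * hAx 0 1 - F x 0 1 * hAx 1 0

end DimTwo

/-! ### Change of charts -/

section Transition

variable {n : ℕ} {M : Type*} [TopologicalSpace M] [ChartedSpace (Cn n) M]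

/-- The vector field with components `u` in the chart `e`. -/
def chartField (e : OpenPartialHomeomorph M (Cn n)) (u : Cn n → Cn n) : VectField n M :=
  fun x => mfderiv 𝓘(ℂ, Cn n) 𝓘(ℂ, Cn n) e.symm (e x) (u (e x))

variable {e e' : OpenPartialHomeomorph M (Cn n)} {z : Cn n}

theorem chartField_symm (u : Cn n → Cn n) (hz : z ∈ e.target) :
    chartField e u (e.symm z) = lift e z (u z) := by
  have h : e (e.symm z) = z := e.right_inv hz
  rw [chartField, lift]
  rw [h]

theorem sesq_chartField (h : SesqField n M) (u v : Cn n → Cn n) {x : M} (hx : x ∈ e.source) :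
    h x (chartField e u x) (chartField e v x)
      = star (v (e x) : Fin n → ℂ) ⬝ᵥ gram e h (e x) *ᵥ u (e x) := by
  obtain ⟨z, hz, rfl⟩ : ∃ z ∈ e.target, e.symm z = x := ⟨e x, e.map_source hx, e.left_inv hx⟩
  rw [chartField_symm u hz, chartField_symm v hz, sesq_lift_lift, e.right_inv hz]

variable [IsManifold 𝓘(ℂ, Cn n) ω M]

/-- The coordinate vectors of one chart, seen in another, have the columns of the Jacobian of the
transition map as components. -/
theorem coordVec_eq_chartField (he : e ∈ atlas (Cn n) M) (he' : e' ∈ atlas (Cn n) M)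
    (hz : z ∈ e'.target) (hx : e'.symm z ∈ e.source) (i : Fin n) :
    coordVec e' z i = chartField e
      (fun _ => fderiv ℂ (e ∘ e'.symm) z (EuclideanSpace.single i 1)) (e'.symm z) := by
  have h1 := (mdifferentiable_chart_of_mem_atlas he).symm_comp_deriv hx
  have h2 := mfderiv_comp z ((mdifferentiable_chart_of_mem_atlas he).mdifferentiableAt hx)
    ((mdifferentiable_chart_of_mem_atlas he').mdifferentiableAt_symm hz)
  have h3 := DFunLike.congr_fun h1 (coordVec e' z i)
  rw [← mfderiv_eq_fderiv, h2]
  exact h3.symm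

theorem contDiffAt_transition (he : e ∈ atlas (Cn n) M) (he' : e' ∈ atlas (Cn n) M)
    (hz : z ∈ e'.target) (hx : e'.symm z ∈ e.source) : ContDiffAt ℂ ω (e ∘ e'.symm) z := by
  have h1 : ContMDiffAt 𝓘(ℂ, Cn n) 𝓘(ℂ, Cn n) ω e (e'.symm z) :=
    contMDiffAt_of_mem_maximalAtlas (IsManifold.subset_maximalAtlas he) hx
  have h2 : ContMDiffAt 𝓘(ℂ, Cn n) 𝓘(ℂ, Cn n) ω e'.symm z :=
    contMDiffAt_symm_of_mem_maximalAtlas (IsManifold.subset_maximalAtlas he') hz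
  exact (h1.comp z h2).contDiffAt

end Transition

/-! ### Flat vector fields -/

section Flat

variable {M : Type*} [TopologicalSpace M] [ChartedSpace (Cn 2) M]
  [IsManifold 𝓘(ℂ, Cn 2) ω M] {e : OpenPartialHomeomorph M (Cn 2)} {h : SesqField 2 M}

/-- If `u` is flat for the Chern connection then `∑ₗ Gₖₗ uˡ` is antiholomorphic. -/
theorem differentiableAt_conj_gram_mulVec (hh : IsHermitian h) (he : e ∈ atlas (Cn 2) M)
    {z : Cn 2} (hz : z ∈ e.target) {u : Cn 2 → Cn 2}
    (hu : ∀ i, DifferentiableAt ℝ (fun w => u w i) z)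
    (hflat : ∀ a i, dz a (fun w => u w i) z + ∑ l, chern e h a z i l * u z l = 0) (k : Fin 2) :
    DifferentiableAt ℂ (fun w => conj ((gram e h w *ᵥ u w) k)) z := by
  have hG := (hh.smooth e he).matDiffAt e.open_target hz
  have hd : ∀ l ∈ Finset.univ, DifferentiableAt ℝ (fun w => gram e h w k l * u w l) z :=
    fun l _ => (hG k l).fun_mul (hu l)
  have hy : DifferentiableAt ℝ (fun w => (gram e h w *ᵥ u w) k) z := by
    simp only [Matrix.mulVec, dotProduct]
    exact DifferentiableAt.fun_sum hd
  refine differentiableAt_of_dzbar_eq_zero hy.star fun a => ?_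
  refine (dzbar_conj a _ z).trans ?_
  rw [map_eq_zero]
  simp only [Matrix.mulVec, dotProduct]
  rw [dz_sum _ _ hd, Finset.sum_congr rfl fun l _ => dz_mul a (hG k l) (hu l)]
  have hGA := fun l => congrFun (congrFun (hh.gram_mul_chern he hz a) k) l
  simp only [Matrix.mul_apply, mdz, Matrix.of_apply] at hGA
  simp only [← hGA, Fin.sum_univ_two] at hflat ⊢
  linear_combination gram e h z k 0 * hflat a 0 + gram e h z k 1 * hflat a 1

/-- A flatness criterion free of connection matrices. Since `∂ᵢ` is holomorphic, `∂ₐ h(X, ∂ᵢ) =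
h(D'ₐ X, ∂ᵢ)`; if each `h(X, ∂ᵢ)` is antiholomorphic, non-degeneracy gives `D'ₐ X = 0`. -/
theorem chernSec_eq_zero (hh : IsHermitian h) (he : e ∈ atlas (Cn 2) M) {X : VectField 2 M}
    {z : Cn 2} (hz : z ∈ e.target)
    (hX : ∀ i, DifferentiableAt ℂ
      (fun w => conj (h (e.symm w) (X (e.symm w)) (coordVec e w i))) z) (a : Fin 2) :
    chernSec e h a X z = 0 := by
  let s : Cn 2 → Cn 2 := fun w => comp e w (X (e.symm w))
  let y : Fin 2 → Cn 2 → ℂ := fun i w => h (e.symm w) (X (e.symm w)) (coordVec e w i)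
  have hy : ∀ i, DifferentiableAt ℝ (y i) z := fun i => by
    have := ((hX i).restrictScalars ℝ).star
    simpa [y] using this
  have hdy : ∀ i, dz a (y i) z = 0 := fun i => by
    have h1 := dzbar_of_complex a (hX i)
    have h2 := dzbar_conj a (y i) z
    rw [← map_eq_zero (starRingEnd ℂ), ← h2]
    exact h1
  have hGs : ∀ w ∈ e.target, ∀ i, (gram e h w *ᵥ s w) i = y i w := by
    intro w hw i
    simp only [y]
    rw [← lift_comp he hw (X (e.symm w)), ← lift_single, sesq_lift_lift]
    rw [PiLp.ofLp_single, ← Pi.single_star, star_one, single_one_dotProduct]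
  have hG := (hh.smooth e he).matDiffAt e.open_target hz
  -- The components of `X` are recovered as `G⁻¹ y`, which supplies the differentiability needed for
  -- the product rule.
  have hs : ∀ k, DifferentiableAt ℝ (fun w => s w k) z := by
    intro k
    have h1 : (fun w => s w k) =ᶠ[nhds z] fun w => ∑ i, (gram e h w)⁻¹ k i * y i w := by
      filter_upwards [e.open_target.mem_nhds hz] with w hw
      have h2 : (gram e h w)⁻¹ *ᵥ (gram e h w *ᵥ s w) = s w := by
        rw [Matrix.mulVec_mulVec, Matrix.nonsing_inv_mul _ (hh.gram_det_ne_zero he hw).isUnit,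
          Matrix.one_mulVec]
      rw [← h2]
      simp only [Matrix.mulVec, dotProduct]
      refine Finset.sum_congr rfl fun i _ => ?_
      rw [← hGs w hw i]
      rfl
    refine DifferentiableAt.congr_of_eventuallyEq ?_ h1
    exact DifferentiableAt.fun_sum fun i _ =>
      ((hh.smooth_inv_gram he).matDiffAt e.open_target hz k i).fun_mul (hy i)
  have hd : ∀ i, ∀ l ∈ Finset.univ, DifferentiableAt ℝ (fun w => gram e h w i l * s w l) z :=
    fun i l _ => (hG i l).fun_mul (hs l)
  have hzero : gram e h z *ᵥ chernSec e h a X z = 0 := by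
    ext i
    have h1 : dz a (fun w => ∑ l, gram e h w i l * s w l) z = 0 := by
      rw [← hdy i]
      exact dz_congr (Filter.mem_of_superset (e.open_target.mem_nhds hz) fun w hw => hGs w hw i)
    rw [dz_sum _ _ (hd i), Finset.sum_congr rfl fun l _ => dz_mul a (hG i l) (hs l)] at h1
    have hGA := fun l => congrFun (congrFun (hh.gram_mul_chern he hz a) i) l
    simp only [Matrix.mul_apply, mdz, Matrix.of_apply] at hGA
    simp only [← hGA, Fin.sum_univ_two, s] at h1
    simp only [Matrix.mulVec, dotProduct, chernSec, Fin.sum_univ_two, Pi.zero_apply]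
    linear_combination h1
  have h2 : (gram e h z)⁻¹ *ᵥ (gram e h z *ᵥ chernSec e h a X z) = chernSec e h a X z := by
    rw [Matrix.mulVec_mulVec, Matrix.nonsing_inv_mul _ (hh.gram_det_ne_zero he hz).isUnit,
      Matrix.one_mulVec]
  rw [← h2, hzero, Matrix.mulVec_zero]

/-- Flatness of a vector field can be checked in one chart. -/
theorem isFlatOn_chartField (hh : IsHermitian h) (he : e ∈ atlas (Cn 2) M) {V : Set (Cn 2)}
    (hVt : V ⊆ e.target) {u : Cn 2 → Cn 2}
    (hu : ∀ z ∈ V, ∀ i, DifferentiableAt ℂ (fun w => u w i) z)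
    (hflat : ∀ z ∈ V, ∀ a i, dz a (fun w => u w i) z + ∑ l, chern e h a z i l * u z l = 0) :
    IsFlatOn h (chartField e u) (e.source ∩ e ⁻¹' V) := by
  intro e' he' z hz hzW a
  refine chernSec_eq_zero hh he' hz (fun i => ?_) a
  have hτ : ContDiffAt ℂ ω (e ∘ e'.symm) z := contDiffAt_transition he he' hz hzW.1
  have hτd : DifferentiableAt ℂ (e ∘ e'.symm) z := hτ.differentiableAt (by simp)
  have hJ : DifferentiableAt ℂ (fun w => fderiv ℂ (e ∘ e'.symm) w (EuclideanSpace.single i 1)) z :=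
    ((hτ.fderiv_right (m := 1) le_top).differentiableAt (by simp)).clm_apply
      (differentiableAt_const _)
  -- Changing chart only contracts `h(X, ∂ₖ)` with the conjugate Jacobian. After conjugation both
  -- factors are holomorphic, so the criterion passes to `e'` without a transformation law for the
  -- connection matrices.
  have heq : (fun w => conj (h (e'.symm w) (chartField e u (e'.symm w)) (coordVec e' w i)))
      =ᶠ[nhds z] fun w => ∑ k, fderiv ℂ (e ∘ e'.symm) w (EuclideanSpace.single i 1) k *
        conj ((gram e h ((e ∘ e'.symm) w) *ᵥ u ((e ∘ e'.symm) w)) k) := by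
    have hopen : IsOpen (e'.target ∩ e'.symm ⁻¹' e.source) :=
      e'.isOpen_inter_preimage_symm e.open_source
    filter_upwards [hopen.mem_nhds ⟨hz, hzW.1⟩] with w hw
    rw [coordVec_eq_chartField he he' hw.1 hw.2, sesq_chartField h _ _ hw.2, dotProduct, map_sum]
    refine Finset.sum_congr rfl fun k _ => ?_
    rw [map_mul]
    simp
  refine DifferentiableAt.congr_of_eventuallyEq ?_ heq
  refine DifferentiableAt.fun_sum fun k _ => DifferentiableAt.fun_mul ?_ ?_
  · exact (EuclideanSpace.proj k : Cn 2 →L[ℂ] ℂ).differentiableAt.comp z hJ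
  · have hmem : (e ∘ e'.symm) z ∈ V := hzW.2
    exact (differentiableAt_conj_gram_mulVec hh he (hVt hmem)
      (fun i => (hu _ hmem i).restrictScalars ℝ) (hflat _ hmem) k).comp z hτd

end Flat

/-! ### Holomorphic vector fields and eigenvalues in a chart -/

section Fields

variable {M : Type*} [TopologicalSpace M] [ChartedSpace (Cn 2) M]
  [IsManifold 𝓘(ℂ, Cn 2) ω M]

/-- The chart has to be a preferred one, `chartAt q`: the trivialization of the tangent bundle at
`q` is its differential, so the section reads there as `u ∘ e`. -/
theorem mdifferentiableOn_chartField (q : M) {V : Set (Cn 2)} {u : Cn 2 → Cn 2}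
    (hu : ∀ z ∈ V, ∀ i, DifferentiableAt ℂ (fun w => u w i) z) :
    MDifferentiableOn 𝓘(ℂ, Cn 2) 𝓘(ℂ, Cn 2).tangent
      (fun x => (⟨x, chartField (chartAt (Cn 2) q) u x⟩ : TangentBundle 𝓘(ℂ, Cn 2) M))
      ((chartAt (Cn 2) q).source ∩ chartAt (Cn 2) q ⁻¹' V) := by
  intro x hx
  set e := chartAt (Cn 2) q with he
  have hea : e ∈ atlas (Cn 2) M := chart_mem_atlas _ q
  have hbase : x ∈ (trivializationAt (Cn 2) (TangentSpace 𝓘(ℂ, Cn 2) : M → Type _) q).baseSet := by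
    simpa using hx.1
  refine MDifferentiableAt.mdifferentiableWithinAt ?_
  refine ((trivializationAt (Cn 2) (TangentSpace 𝓘(ℂ, Cn 2) : M → Type _)
    q).mdifferentiableAt_section_iff 𝓘(ℂ, Cn 2) (chartField e u) hbase).2 ?_
  have hu' : DifferentiableAt ℂ u (e x) := by
    rw [differentiableAt_euclidean]
    exact hu _ hx.2
  have hd : MDifferentiableAt 𝓘(ℂ, Cn 2) 𝓘(ℂ, Cn 2) (u ∘ e) x :=
    hu'.mdifferentiableAt.comp x
      ((mdifferentiable_chart_of_mem_atlas hea).mdifferentiableAt hx.1)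
  refine hd.congr_of_eventuallyEq ?_
  filter_upwards [e.open_source.mem_nhds hx.1] with y hy
  have h1 := TangentBundle.continuousLinearMapAt_trivializationAt (I := 𝓘(ℂ, Cn 2)) hy
  have h2 := DFunLike.congr_fun h1 (chartField e u y)
  rw [Bundle.Trivialization.continuousLinearMapAt_apply,
    Bundle.Trivialization.linearMapAt_apply, if_pos (by simpa using hy)] at h2
  rw [h2]
  obtain ⟨z, hz, rfl⟩ : ∃ z ∈ e.target, e.symm z = y := ⟨e y, e.map_source hy, e.left_inv hy⟩
  rw [chartField_symm u hz, Function.comp_apply, e.right_inv hz]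
  refine Eq.trans ?_ (comp_lift hea hz (u z))
  rfl

variable {e : OpenPartialHomeomorph M (Cn 2)} {z : Cn 2}

theorem hasEigenvalue_iff_det {A : EndField 2 M} (he : e ∈ atlas (Cn 2) M) (hz : z ∈ e.target)
    (μ : ℂ) : (A (e.symm z)).HasEigenvalue μ ↔ (endMat e A z - μ • 1).det = 0 := by
  rw [← Matrix.exists_mulVec_eq_zero_iff]
  constructor
  · intro h
    obtain ⟨v, hv⟩ := h.exists_hasEigenvector
    have hne := hv.2
    have hev := hv.apply_eq_smul
    rw [← lift_comp he hz v] at hev hne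
    refine ⟨comp e z v, fun h0 => hne ?_, ?_⟩
    · have h1 : comp e z v = 0 := by ext i; exact congrFun h0 i
      rw [h1]
      exact map_zero (mfderiv 𝓘(ℂ, Cn 2) 𝓘(ℂ, Cn 2) e.symm z)
    · rw [Matrix.sub_mulVec, sub_eq_zero, Matrix.smul_mulVec, Matrix.one_mulVec]
      ext i
      rw [← comp_end_lift, hev]
      have h1 := comp_lift he hz (μ • comp e z v)
      have h2 : lift e z (μ • comp e z v) = μ • lift e z (comp e z v) :=
        map_smul (mfderiv 𝓘(ℂ, Cn 2) 𝓘(ℂ, Cn 2) e.symm z) _ _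
      rw [← h2, h1]
      rfl
  · rintro ⟨v, hv, hv0⟩
    rw [Matrix.sub_mulVec, sub_eq_zero, Matrix.smul_mulVec, Matrix.one_mulVec] at hv0
    refine Module.End.hasEigenvalue_of_hasEigenvector (x := lift e z (WithLp.toLp 2 v)) ⟨?_, ?_⟩
    · rw [Module.End.mem_eigenspace_iff, end_lift A he hz, hv0]
      exact map_smul (mfderiv 𝓘(ℂ, Cn 2) 𝓘(ℂ, Cn 2) e.symm z) μ (WithLp.toLp 2 v)
    · intro h0
      have := lift_eq_zero he hz h0
      exact hv (by simpa using this)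

end Fields

/-! ### Vanishing of the Higgs field and construction of the flat frame -/

section Main

variable {M : Type*} [TopologicalSpace M] [ChartedSpace (Cn 2) M]
  {h : SesqField 2 M} {Φ : HiggsField 2 M} {κ : AntiField 2 M} {U Q : EndField 2 M}
  {e : OpenPartialHomeomorph M (Cn 2)} {z : Cn 2}

theorem IsTTStarBundle.comm_higgs (htt : IsTTStarBundle h Φ κ U Q) (hU : IsChernParallel h U)
    (he : e ∈ atlas (Cn 2) M) (hz : z ∈ e.target) (a : Fin 2) :
    comm (higgsMat e Φ a z) (endMat e Q z) = higgsMat e Φ a z := by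
  have h1 := htt.integrable.chern_U e he z hz a
  rw [hU e he z hz a, zero_sub, neg_add_eq_zero] at h1
  exact h1

theorem isHolomorphicChernOn_of_higgs_eq_zero (hH : IsHarmonicHiggs h Φ) {W : Set M}
    (hW : ∀ x ∈ W, Φ x = 0) : IsHolomorphicChernOn h W := by
  intro e he z hz hzW a b
  rw [hH.curvature e he z hz a b, higgsMat_eq_zero (hW _ hzW), comm, zero_mul, mul_zero, sub_zero]

variable [IsManifold 𝓘(ℂ, Cn 2) ω M]

theorem IsTTStarBundle.trace_Q (htt : IsTTStarBundle h Φ κ U Q) (he : e ∈ atlas (Cn 2) M)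
    (hz : z ∈ e.target) : (endMat e Q z).trace = 0 :=
  trace_endMat_eq_zero htt.integrable.harmonic.hermitian htt.real.invol htt.Q_star he hz

/-- Invertibility of `Q - 1/2` is an open condition, by continuity of its determinant; wherever it
holds, `Φ` vanishes. -/
theorem IsTTStarBundle.exists_higgs_eq_zero (htt : IsTTStarBundle h Φ κ U Q)
    (hU : IsChernParallel h U) {p : M} (hp : ¬ (Q p).HasEigenvalue (1 / 2)) :
    ∃ W : Set M, IsOpen W ∧ p ∈ W ∧ ∀ x ∈ W, Φ x = 0 := by
  obtain ⟨e, he, hpe⟩ : ∃ e ∈ atlas (Cn 2) M, p ∈ e.source :=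
    ⟨chartAt _ p, chart_mem_atlas _ p, mem_chart_source _ p⟩
  have hcont : ContinuousOn (fun w => (endMat e Q w - (1 / 2 : ℂ) • 1).det) e.target := by
    have hQ := fun i j => (htt.integrable.smooth_Q e he i j).continuousOn
    simp only [Matrix.det_fin_two, Matrix.sub_apply]
    exact (((hQ 0 0).sub continuousOn_const).mul ((hQ 1 1).sub continuousOn_const)).sub
      (((hQ 0 1).sub continuousOn_const).mul ((hQ 1 0).sub continuousOn_const))
  have hopen := hcont.isOpen_inter_preimage e.open_target (isOpen_compl_singleton (x := (0 : ℂ)))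
  refine ⟨_, e.isOpen_inter_preimage hopen, ?_, ?_⟩
  · obtain ⟨z, hz, rfl⟩ : ∃ z ∈ e.target, e.symm z = p := ⟨e p, e.map_source hpe, e.left_inv hpe⟩
    rw [hasEigenvalue_iff_det he hz] at hp
    refine ⟨hpe, ?_⟩
    rw [Set.mem_preimage, e.right_inv hz]
    exact ⟨hz, hp⟩
  · rintro x ⟨hx, hx', hxd⟩
    rw [← e.left_inv hx]
    exact higgs_eq_zero he hx' fun a =>
      eq_zero_of_comm_eq (htt.comm_higgs hU he hx' a) (htt.trace_Q he hx') hxd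

/-- The curvature identity with equal indices turns holomorphy of `D'` into normality of each
component of `Φ`, which is already nilpotent. -/
theorem IsTTStarBundle.higgs_eq_zero (htt : IsTTStarBundle h Φ κ U Q) (hpos : PosDef h)
    (hU : IsChernParallel h U) (hflat : IsHolomorphicChernOn h (Set.univ : Set M)) (x : M) :
    Φ x = 0 := by
  obtain ⟨e, he, hx⟩ : ∃ e ∈ atlas (Cn 2) M, x ∈ e.source :=
    ⟨chartAt _ x, chart_mem_atlas _ x, mem_chart_source _ x⟩
  have hz := e.map_source hx
  have hH := htt.integrable.harmonic
  rw [← e.left_inv hx]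
  refine TTStar.higgs_eq_zero he hz fun a => ?_
  refine eq_zero_of_normal_of_sq_eq_zero hH.hermitian.gram_conjTranspose
    (hH.hermitian.gram_det_ne_zero he hz) (hpos.gram_definite he hz)
    (mul_self_eq_zero_of_comm_eq (htt.comm_higgs hU he hz a) (htt.trace_Q he hz)) ?_
  exact (hH.curvature e he _ hz a a).symm.trans (hflat e he _ hz trivial a a)

/-- Local flat holomorphic eigenvector fields of a parallel holomorphic endomorphism with
eigenvalues `±1/2`. -/
theorem exists_flat_eigenvector {Ω : Set (Cn 2)} (hΩ : IsOpen Ω)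
    {A : Fin 2 → Cn 2 → Matrix (Fin 2) (Fin 2) ℂ} {F : Cn 2 → Matrix (Fin 2) (Fin 2) ℂ}
    (hA : ∀ z ∈ Ω, ∀ a i j, DifferentiableAt ℂ (fun w => A a w i j) z)
    (hF : ∀ z ∈ Ω, ∀ i j, DifferentiableAt ℂ (fun w => F w i j) z)
    (hcurv : ∀ z ∈ Ω, ∀ a b, mdz a (A b) z - mdz b (A a) z + comm (A a z) (A b z) = 0)
    (hFA : ∀ z ∈ Ω, ∀ a, mdz a F z + comm (A a z) (F z) = 0)
    (htr : ∀ z ∈ Ω, (F z).trace = 0) {z₀ : Cn 2} (hz₀ : z₀ ∈ Ω) (hdet : (F z₀).det = -1 / 4)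
    {ε : ℂ} (hε : ε * ε = 1) :
    ∃ r > 0, Metric.ball z₀ r ⊆ Ω ∧ ∃ u : Cn 2 → Cn 2, ∀ z ∈ Metric.ball z₀ r, u z ≠ 0 ∧
      F z *ᵥ u z = (ε / 2) • (u z : Fin 2 → ℂ) ∧
      (∀ i, DifferentiableAt ℂ (fun w => u w i) z) ∧
        ∀ a i, dz a (fun w => u w i) z + ∑ l, A a z i l * u z l = 0 := by
  obtain ⟨ρ, hρ, hball⟩ := Metric.isOpen_iff.mp hΩ z₀ hz₀
  have hdet' : ∀ z ∈ Metric.ball z₀ ρ, (F z).det = -1 / 4 := fun z hz =>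
    (det_eq_of_parallel (convex_ball z₀ ρ) Metric.isOpen_ball (fun z hz => hF z (hball hz))
      (fun z hz => hFA z (hball hz)) hz (Metric.mem_ball_self hρ)).trans hdet
  -- The spectral projector of `F` onto the eigenvalue `ε/2`: since `F² = 1/4` and `ε² = 1`, one has
  -- `F P = (ε/2) P`. Its trace is 1 and its determinant 0, so its rank is one.
  let P : Cn 2 → Matrix (Fin 2) (Fin 2) ℂ := fun z => (1 / 2 : ℂ) • 1 + ε • F z
  have hPF : ∀ z ∈ Metric.ball z₀ ρ, F z * P z = (ε / 2) • P z := by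
    intro z hz
    simp only [P, mul_add, Matrix.mul_smul, mul_one, smul_add, smul_smul,
      mul_self_of_trace_eq_zero (htr z (hball hz)), hdet' z hz]
    have h1 : ε / 2 * ε = 1 / 2 := by linear_combination hε / 2
    rw [h1, add_comm]
    congr 2
    ring
  have hP : ∀ z ∈ Metric.ball z₀ ρ, ∀ i j, DifferentiableAt ℂ (fun w => P w i j) z :=
    fun z hz i j => (differentiableAt_const _).fun_add ((hF z (hball hz) i j).const_mul ε)
  obtain ⟨r, hr, hrb, u, c, j, hu⟩ := exists_flat_section (A := A) (P := P) Metric.isOpen_ball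
    (fun z hz => hA z (hball hz)) hP (fun z hz => hcurv z (hball hz)) (fun z hz a => by
      have h1 : mdz a P z = ε • mdz a F z := by
        ext i l
        have hd := (hF z (hball hz) i l).restrictScalars ℝ
        simp only [mdz, Matrix.of_apply, Matrix.smul_apply, smul_eq_mul, P, Matrix.add_apply, dz]
        rw [fderiv_const_add, fderiv_const_mul hd]
        simp only [smul_apply, smul_eq_mul]
        ring
      have h2 := hFA z (hball hz) a
      have h3 : comm (A a z) (P z) = ε • comm (A a z) (F z) := by
        simp only [comm, P, mul_add, add_mul, Matrix.mul_smul, Matrix.smul_mul, mul_one, one_mul,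
          smul_sub]
        abel
      rw [h1, h3, ← smul_add, h2, smul_zero])
    (fun z hz => by
      have h1 := htr z (hball hz)
      have h2 := hdet' z hz
      rw [Matrix.trace_fin_two] at h1
      rw [Matrix.det_fin_two] at h2 ⊢
      simp only [P, Matrix.add_apply, Matrix.smul_apply, smul_eq_mul, Matrix.one_apply_eq]
      rw [Matrix.one_apply_ne (by decide), Matrix.one_apply_ne (by decide)]
      linear_combination ε / 2 * h1 + ε * ε * h2 - hε / 4)
    (Metric.mem_ball_self hρ) (fun h0 => by
      have h1 := congrArg Matrix.trace h0
      simp only [P, Matrix.trace_add, Matrix.trace_smul, htr z₀ hz₀] at h1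
      simp at h1)
  refine ⟨r, hr, hrb.trans hball, u, fun z hz => ?_⟩
  obtain ⟨hne, hcol, hd, hfl⟩ := hu z hz
  refine ⟨hne, ?_, hd, hfl⟩
  ext i
  have h1 := congrFun (congrFun (hPF z (hrb hz)) i) j
  rw [Matrix.mul_apply] at h1
  simp only [Matrix.mulVec, dotProduct, Pi.smul_apply, smul_eq_mul, hcol]
  calc ∑ k, F z i k * (c z * P z k j) = c z * ∑ k, F z i k * P z k j := by
        rw [Finset.mul_sum]
        exact Finset.sum_congr rfl fun k _ => by ring
    _ = _ := by
        rw [h1, Matrix.smul_apply, smul_eq_mul]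
        ring

theorem IsTTStarBundle.exists_flat_frame (htt : IsTTStarBundle h Φ κ U Q) (hpos : PosDef h)
    (hU : IsChernParallel h U) (hflat : IsHolomorphicChernOn h (Set.univ : Set M)) {p : M}
    (hp : (Q p).HasEigenvalue (1 / 2)) :
    ∃ W : Set M, IsOpen W ∧ p ∈ W ∧ ∃ X : Fin 2 → VectField 2 M, IsFlatHolomorphicFrameOn h X W ∧
      ∀ x ∈ W, ∀ j, Q x (X j x) = (![1 / 2, -1 / 2] : Fin 2 → ℂ) j • X j x := by
  -- The centre `q` is kept separate from `p`, so that `p` can be replaced by `e.symm z₀` while the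
  -- chart stays fixed.
  obtain ⟨q, hpq⟩ : ∃ q : M, p ∈ (chartAt (Cn 2) q).source := ⟨p, mem_chart_source _ p⟩
  set e := chartAt (Cn 2) q with he_def
  have he : e ∈ atlas (Cn 2) M := chart_mem_atlas _ q
  obtain ⟨z₀, hz₀, rfl⟩ : ∃ z ∈ e.target, e.symm z = p := ⟨e p, e.map_source hpq, e.left_inv hpq⟩
  have hH := htt.integrable.harmonic
  have hh := hH.hermitian
  have hΦ := htt.higgs_eq_zero hpos hU hflat
  have hDQ : ∀ z ∈ e.target, ∀ a, chernEnd e h a (endMat e Q) z = 0 := by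
    intro z hz a
    have h1 := htt.integrable.chern_Q e he z hz a
    rwa [higgsMat_eq_zero (hΦ _), comm, zero_mul, mul_zero, sub_zero, add_zero] at h1
  have hQs := htt.integrable.smooth_Q e he
  have hQd : ∀ z ∈ e.target, ∀ i j, DifferentiableAt ℂ (fun w => endMat e Q w i j) z :=
    fun z hz => differentiableAt_of_mdzbar (hQs.matDiffAt e.open_target hz) fun a =>
      mdzbar_endMat_eq_zero hh htt.integrable.Q_selfAdj he hQs hz a (hDQ z hz a)
  have hAd : ∀ z ∈ e.target, ∀ a i j, DifferentiableAt ℂ (fun w => chern e h a w i j) z :=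
    fun z hz a => differentiableAt_of_mdzbar ((hh.smooth_chern he a).matDiffAt e.open_target hz)
      fun b => hflat e he z hz trivial a b
  -- The eigenvalue equation is `det Q - tr Q / 2 + 1/4 = 0`, and the trace vanishes.
  have hdet : (endMat e Q z₀).det = -1 / 4 := by
    have h1 := (hasEigenvalue_iff_det he hz₀ _).mp hp
    have h2 := htt.trace_Q he hz₀
    rw [Matrix.trace_fin_two] at h2
    rw [Matrix.det_fin_two] at h1 ⊢
    simp only [Matrix.sub_apply, Matrix.smul_apply, smul_eq_mul, Matrix.one_apply_eq] at h1
    rw [Matrix.one_apply_ne (by decide), Matrix.one_apply_ne (by decide)] at h1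
    linear_combination h1 + h2 / 2
  have key := fun ε hε => exists_flat_eigenvector (ε := ε) e.open_target hAd hQd
    (hH.chern_sq e he) hDQ (fun z hz => htt.trace_Q he hz) hz₀ hdet hε
  obtain ⟨r, hr, hrt, u, hu⟩ := key 1 (by norm_num)
  obtain ⟨r', hr', -, u', hu'⟩ := key (-1) (by norm_num)
  set V := Metric.ball z₀ (min r r') with hV
  have hVr : V ⊆ Metric.ball z₀ r := Metric.ball_subset_ball (min_le_left _ _)
  have hVr' : V ⊆ Metric.ball z₀ r' := Metric.ball_subset_ball (min_le_right _ _)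
  let v : Fin 2 → Cn 2 → Cn 2 := ![u, u']
  let μ : Fin 2 → ℂ := ![1 / 2, -1 / 2]
  have hv : ∀ j, ∀ z ∈ V, v j z ≠ 0 ∧ endMat e Q z *ᵥ v j z = μ j • (v j z : Fin 2 → ℂ) ∧
      (∀ i, DifferentiableAt ℂ (fun w => v j w i) z) ∧
        ∀ a i, dz a (fun w => v j w i) z + ∑ l, chern e h a z i l * v j z l = 0 := by
    intro j z hz
    fin_cases j
    · exact hu z (hVr hz)
    · exact hu' z (hVr' hz)
  have hQX : ∀ x ∈ e.source ∩ e ⁻¹' V, ∀ j,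
      Q x (chartField e (v j) x) = μ j • chartField e (v j) x ∧ chartField e (v j) x ≠ 0 := by
    rintro x ⟨hx, hxV⟩ j
    obtain ⟨z, hz, rfl⟩ : ∃ z ∈ e.target, e.symm z = x := ⟨e x, e.map_source hx, e.left_inv hx⟩
    rw [Set.mem_preimage, e.right_inv hz] at hxV
    obtain ⟨h1, h2, -⟩ := hv j z hxV
    rw [chartField_symm _ hz]
    refine ⟨?_, fun h0 => h1 (lift_eq_zero he hz h0)⟩
    rw [end_lift Q he hz, h2]
    exact map_smul (mfderiv 𝓘(ℂ, Cn 2) 𝓘(ℂ, Cn 2) e.symm z) (μ j) (v j z)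
  refine ⟨e.source ∩ e ⁻¹' V, e.isOpen_inter_preimage Metric.isOpen_ball,
    ⟨hpq, ?_⟩, fun j => chartField e (v j), ⟨?_, ?_, ?_⟩, fun x hx j => (hQX x hx j).1⟩
  · rw [Set.mem_preimage, e.right_inv hz₀]
    exact Metric.mem_ball_self (lt_min hr hr')
  · exact fun j => mdifferentiableOn_chartField q fun z hz => (hv j z hz).2.2.1
  · intro x hx
    have hμ : Function.Injective μ := by
      intro i j hij
      fin_cases i <;> fin_cases j <;> simp [μ] at hij ⊢ <;> norm_num at hij
    -- The frame is independent because its members belong to the distinct eigenvalues `1/2` and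
    -- `-1/2`.
    exact Module.End.eigenvectors_linearIndependent' (Q x) μ hμ _ fun j =>
      ⟨Module.End.mem_eigenspace_iff.mpr (hQX x hx j).1, (hQX x hx j).2⟩
  · exact fun j => isFlatOn_chartField hh he (hVr.trans hrt) (fun z hz => (hv j z hz).2.2.1)
      fun z hz => (hv j z hz).2.2.2

end Main

end TTStar

end

/-! ### Assembly of the two statements -/

theorem mainTheorem5 {M : Type*} [TopologicalSpace M] [ChartedSpace (TTStar.Cn 2) M]
    [IsManifold 𝓘(ℂ, TTStar.Cn 2) ω M]
    (h : TTStar.SesqField 2 M) (Φ : TTStar.HiggsField 2 M) (κ : TTStar.AntiField 2 M)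
    (U Q : TTStar.EndField 2 M)
    (htt : TTStar.IsTTStarBundle h Φ κ U Q) (hpos : TTStar.PosDef h)
    (hU : TTStar.IsChernParallel h U) (p : M) :
    ((¬ (Q p).HasEigenvalue (1 / 2) ∧ ¬ (Q p).HasEigenvalue (-1 / 2)) →
      ∃ W : Set M, IsOpen W ∧ p ∈ W ∧ (∀ x ∈ W, Φ x = 0) ∧
        TTStar.IsHolomorphicChernOn h W) ∧
    ((Q p).HasEigenvalue (1 / 2) → TTStar.IsHolomorphicChernOn h (Set.univ : Set M) →
      ∃ W : Set M, IsOpen W ∧ p ∈ W ∧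
        (∃ X : Fin 2 → TTStar.VectField 2 M, TTStar.IsFlatHolomorphicFrameOn h X W ∧
          ∀ x ∈ W, ∀ j, Q x (X j x) =
            ∑ i, (!![1 / 2, 0; 0, -1 / 2] : Matrix (Fin 2) (Fin 2) ℂ) i j • X i x) ∧
        ∀ x ∈ W, Φ x = 0) := by
  constructor
  · rintro ⟨hp, -⟩
    obtain ⟨W, hWo, hpW, hW⟩ := htt.exists_higgs_eq_zero hU hp
    exact ⟨W, hWo, hpW, hW, TTStar.isHolomorphicChernOn_of_higgs_eq_zero htt.integrable.harmonic hW⟩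
  · intro hp hflat
    obtain ⟨W, hWo, hpW, X, hX, hQ⟩ := htt.exists_flat_frame hpos hU hflat hp
    refine ⟨W, hWo, hpW, ⟨X, hX, fun x hx j => ?_⟩, fun x _ => htt.higgs_eq_zero hpos hU hflat x⟩
    rw [hQ x hx j, Fin.sum_univ_two]
    fin_cases j <;> simp
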